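/- **Setting.** Fix $N,n\ge 0$ and $r_1,\dots,r_n,r_\infty\ge 0$. Let $({\bf t},{\bf D})$ range over an open set $\mathfrak P$ of a finite-dimensional real vector space $\mathfrak T\times\mathfrak D$, and let $$B(\zeta)=\sum_{\nu=1}^n\sum_{k=0}^{r_\nu}\frac{B_{\nu,-k}}{(\zeta-b^{(\nu)})^{k+1}}-\sum_{k=1}^{r_\infty}B_{\infty,-k}\,\zeta^{k-1}$$ be an $N\times N$ matrix depending on $({\bf t},{\bf D})$. Put $F(\zeta,\mu)=\det(B(\zeta)-\mu I)$ and let $\Gamma_{({\bf t},{\bf D})}=\{(\zeta,\mu): \zeta\ne b^{(\nu)}\ \forall\nu,\ F(\zeta,\mu)=0\}$ be the spectral curve punctured over $b^{(1)},\dots,b^{(n)},\infty$. The branches of $\mu$ are $\mu_i=\sum_{k=0}^{r_\nu}(t^{(\nu)}_{-k})_{ii}(\zeta-b^{(\nu)})^{-k-1}+O(1)$ as $\zeta\to b^{(\nu)}$, and $\mu_i=-\sum_{k=1}^{r_\infty}(t^{(\infty)}_{-k})_{ii}\zeta^{k-1}-(t^{(\infty)}_0)_{ii}\zeta^{-1}+O(\zeta^{-2})$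 as $\zeta\to\infty$. The $b^{(\nu)}$ and $t^{(\nu)}_{-k}$ are continuous in the parameters; $b^{(\nu)}$, $t^{(\nu)}_{-k}$ $(k\ne0)$ and $\mathrm{Re}\,t_0^{(\nu)}$ depend on ${\bf t}$ only, and $\mathrm{Im}\,t_0^{(\nu)}$ on ${\bf D}$ only. Let $\mathfrak F$ (fixed singularities) be the union of the sets $b^{(\nu)}=b^{(\rho)}$ $(\nu\ne\rho)$, $(t^{(\nu)}_{-r_\nu})_{ii}=(t^{(\nu)}_{-r_\nu})_{jj}$ $(i\neq j)$ and $(t^{(\nu)}_{-r_\nu})_{kk}=0$ $(\nu=1,\dots,n,\infty)$. Outside $\mathfrak F$, $F$ is continuously differentiable jointly in $({\bf t},{\bf D},\zeta,\mu)$ for $\zeta\neq b^{(\nu)}$. The asymptotics of the $\mu_i$ are likewise required only outside $\mathfrak F$. Let $\mathfrak S$ (discriminant set) be the set of parameters for which $\Gamma$ has a singular point, i.e. a point with $F=\partial_\zeta F=\partial_\mu F=0$. Closed paths are piecewise $C^1$, and $J_\ell=\mathrm{Re}\oint_\ell\mu\,d\zeta$. A *continuous family* of closed paths over $W\subseteq\mathfrak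 P\setminus\mathfrak F$ consists of closed paths $\ell_p:[0,1]\to\Gamma_p$, $p\in W$, with $\ell_p(s)$ jointly continuous in $(p,s)\in W\times[0,1]$. **Proposition.** 1. (Continuity outside $\mathfrak F$.) Let $(\ell_p)_{p\in W}$ be a continuous family of closed paths over any set $W\subseteq\mathfrak P\setminus\mathfrak F$ (which may meet $\mathfrak S$), such that, near each $p\in W$ for which $\ell_p$ passes through a singular point of $\Gamma_p$, the lengths of the projections of the $\ell_{p'}$, $p'\in W$, to the $\zeta$-plane are bounded. Then $p\mapsto J_{\ell_p}$ is continuous on $W$. 2. (Differentiability outside $\mathfrak S$.) For every continuous family of closed paths over a set $W\subseteq\mathfrak P\setminus\mathfrak F$, the function $p\mapsto J_{\ell_p}$ is (real) differentiable within $W$ at each $p\in W\setminus\mathfrak S$, and also at each $p\in W\cap\mathfrak S$ for which $\ell_p$ avoids the singular points of $\Gamma_p$. 3. (A single path.) Let $p_0\in\mathfrak P\setminus\mathfrak F$ and let $\ell$ be a closed path on $\Gamma_{p_0}$; if $p_0\in\mathfrak S$, assume that $\ell$ avoids the singular points of $\Gamma_{p_0}$. Then for every $\varepsilon_0>0$ there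 are $0<\varepsilon<\varepsilon_0$, an open neighbourhood $V\subseteq\mathfrak P\setminus\mathfrak F$ of $p_0$ and a differentiable function $J_\ell:V\to\mathbb R$ such that for every $p\in V$ there is a closed path on $\Gamma_p$ that is uniformly $\varepsilon$-close to $\ell$, and every such path $\ell'$ satisfies $\mathrm{Re}\oint_{\ell'}\mu\,d\zeta=J_\ell(p)$. -/

import Mathlib

open scoped Topology unitInterval

noncomputable section

/-- The data of an `N × N` rational coefficient matrix at `δ = 0`,
`B(ζ) = ∑_ν ∑_{k=0}^{r_ν} B_{ν,-k} / (ζ - b^{(ν)})^{k+1} - ∑_{k=1}^{r_∞} B_{∞,-k} ζ^{k-1}`,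
as a function of the parameters `(𝐭, 𝐃) ∈ T × D`.  Singularities are labelled by `Option (Fin n)`;
`some ν` is the finite singularity `b^{(ν)}` and `none` is infinity.

* `dom` is the total parameter space `𝔓`;
* `b ν` is the position of the `ν`-th finite singularity;
* `t ν k i` is the `i`-th diagonal entry of `t_{-k}^{(ν)}` (used for `k ≤ r_ν`);
* `B ν k` is the matrix `B_{ν,-k}` (used for `k ≤ r_ν`; for `ν = ∞` only with `1 ≤ k`). -/
structure SpectralData (N n : ℕ) (r : Option (Fin n) → ℕ) (T D : Type*) where
  dom : Set (T × D)
  b : Fin n → T × D → ℂ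
  t : Option (Fin n) → ℕ → Fin N → T × D → ℂ
  B : Option (Fin n) → ℕ → T × D → Matrix (Fin N) (Fin N) ℂ

namespace SpectralData

variable {N n : ℕ} {r : Option (Fin n) → ℕ} {T D : Type*}

/-- The matrix `B(ζ)` at the parameter value `p = (𝐭, 𝐃)`. -/
def coeffMatrix (S : SpectralData N n r T D) (p : T × D) (ζ : ℂ) : Matrix (Fin N) (Fin N) ℂ :=
  ∑ ν : Fin n, ∑ k ∈ Finset.range (r (some ν) + 1),
      ((ζ - S.b ν p) ^ (k + 1))⁻¹ • S.B (some ν) k p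
    - ∑ k ∈ Finset.Icc 1 (r none), ζ ^ (k - 1) • S.B none k p

/-- `F(ζ, μ) = det (B(ζ) - μ I)`. -/
def F (S : SpectralData N n r T D) (p : T × D) (ζ μ : ℂ) : ℂ :=
  (S.coeffMatrix p ζ - μ • (1 : Matrix (Fin N) (Fin N) ℂ)).det

/-- The spectral curve `Γ_as` punctured over the points `b^{(ν)}`, `ν = 1, …, n, ∞`:
the pairs `(ζ, μ)` with `F(ζ, μ) = 0` and `ζ` finite and different from all `b^{(ν)}`. -/
def curve (S : SpectralData N n r T D) (p : T × D) : Set (ℂ × ℂ) :=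
  {x | (∀ ν, x.1 ≠ S.b ν p) ∧ S.F p x.1 x.2 = 0}

/-- The singular points of the punctured curve: `F = ∂F/∂ζ = ∂F/∂μ = 0`. -/
def singularPoints (S : SpectralData N n r T D) (p : T × D) : Set (ℂ × ℂ) :=
  {x | x ∈ S.curve p ∧ deriv (fun ζ => S.F p ζ x.2) x.1 = 0 ∧
    deriv (fun μ => S.F p x.1 μ) x.2 = 0}

/-- The fixed singularities `𝔉`: the union of `b^{(ν)} = b^{(ρ)}` (`ν ≠ ρ`),
`(t_{-r_ν}^{(ν)})_{ii} = (t_{-r_ν}^{(ν)})_{jj}` (`i ≠ j`) and `(t_{-r_ν}^{(ν)})_{kk} = 0`. -/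
def fixedSing (S : SpectralData N n r T D) : Set (T × D) :=
  {p | (∃ ν ρ, ν ≠ ρ ∧ S.b ν p = S.b ρ p) ∨
    (∃ ν i j, i ≠ j ∧ S.t ν (r ν) i p = S.t ν (r ν) j p) ∨
    (∃ ν k, S.t ν (r ν) k p = 0)}

/-- The discriminant set `𝔖`: the parameter values at which the spectral curve is singular. -/
def discrSet (S : SpectralData N n r T D) : Set (T × D) :=
  {p | p ∈ S.dom ∧ (S.singularPoints p).Nonempty}

/-- `S` is a parameterization of the spectral curve by the deformation parameters `𝐭` and the
remaining parameters `𝐃`. -/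
structure IsParameterization [NormedAddCommGroup T] [NormedSpace ℝ T]
    [NormedAddCommGroup D] [NormedSpace ℝ D] (S : SpectralData N n r T D) : Prop where
  isOpen_dom : IsOpen S.dom
  continuousOn_b : ∀ ν, ContinuousOn (S.b ν) S.dom
  continuousOn_t : ∀ ν k i, k ≤ r ν → ContinuousOn (S.t ν k i) S.dom
  /-- The positions `b^{(ν)}`, the entries of `t_{-k}^{(ν)}` with `k ≠ 0`, and `Re t_0^{(ν)}` are
  functions of `𝐭` only, while `Im t_0^{(ν)}` is a function of `𝐃` only. -/
  b_eq : ∀ p ∈ S.dom, ∀ p' ∈ S.dom, p.1 = p'.1 → ∀ ν, S.b ν p = S.b ν p'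
  t_eq : ∀ p ∈ S.dom, ∀ p' ∈ S.dom, p.1 = p'.1 → ∀ ν i, ∀ k ∈ Finset.Icc 1 (r ν),
    S.t ν k i p = S.t ν k i p'
  re_t_zero_eq : ∀ p ∈ S.dom, ∀ p' ∈ S.dom, p.1 = p'.1 → ∀ ν i,
    (S.t ν 0 i p).re = (S.t ν 0 i p').re
  im_t_zero_eq : ∀ p ∈ S.dom, ∀ p' ∈ S.dom, p.2 = p'.2 → ∀ ν i,
    (S.t ν 0 i p).im = (S.t ν 0 i p').im
  /-- The curve depends in a continuously differentiable way on the parameters. -/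
  contDiffOn_F : ContDiffOn ℝ 1 (fun q : (T × D) × ℂ × ℂ => S.F q.1 q.2.1 q.2.2)
    {q | q.1 ∈ S.dom \ S.fixedSing ∧ ∀ ν, q.2.1 ≠ S.b ν q.1}
  /-- The `t_{-k}^{(ν)}` give the singular part of the branches of `μ dζ` over `b^{(ν)}`:
  `μ_i(ζ) = ∑_{k=0}^{r_ν} (t_{-k}^{(ν)})_{ii} (ζ - b^{(ν)})^{-k-1} + O(1)`. -/
  singular_part : ∀ p ∈ S.dom \ S.fixedSing, ∀ ν : Fin n, ∃ m : Fin N → ℂ → ℂ,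
    (∀ᶠ ζ in 𝓝[≠] (S.b ν p), (S.coeffMatrix p ζ).charpoly =
      ∏ i, (Polynomial.X - Polynomial.C (m i ζ))) ∧
    ∀ i, (fun ζ => m i ζ - ∑ k ∈ Finset.range (r (some ν) + 1),
      S.t (some ν) k i p / (ζ - S.b ν p) ^ (k + 1)) =O[𝓝[≠] (S.b ν p)] (fun _ => (1 : ℂ))
  /-- The same at infinity:
  `μ_i(ζ) = -∑_{k=1}^{r_∞} (t_{-k}^{(∞)})_{ii} ζ^{k-1} - (t_0^{(∞)})_{ii} ζ^{-1} + O(ζ^{-2})`. -/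
  singular_part_infty : ∀ p ∈ S.dom \ S.fixedSing, ∃ m : Fin N → ℂ → ℂ,
    (∀ᶠ ζ in Bornology.cobounded ℂ, (S.coeffMatrix p ζ).charpoly =
      ∏ i, (Polynomial.X - Polynomial.C (m i ζ))) ∧
    ∀ i, (fun ζ => m i ζ + ∑ k ∈ Finset.Icc 1 (r none), S.t none k i p * ζ ^ (k - 1)
      + S.t none 0 i p / ζ) =O[Bornology.cobounded ℂ] (fun ζ => (ζ ^ 2)⁻¹)

end SpectralData

/-- Piecewise continuously differentiable paths in `ℂ × ℂ`. -/
def IsPiecewiseC1 {x y : ℂ × ℂ} (γ : Path x y) : Prop :=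
  ∃ (m : ℕ) (s : ℕ → ℝ), Monotone s ∧ s 0 = 0 ∧ s m = 1 ∧
    ∀ i < m, ContDiffOn ℝ 1 γ.extend (Set.Icc (s i) (s (i + 1)))

/-- The 1-form `μ dζ` on `ℂ × ℂ`. -/
def muForm (x : ℂ × ℂ) : ℂ × ℂ →L[ℂ] ℂ := x.2 • ContinuousLinearMap.fst ℂ ℂ ℂ

/-- `J_ℓ = Re ∮_ℓ μ dζ`. -/
def periodJ {x : ℂ × ℂ} (ℓ : Path x x) : ℝ := (curveIntegral muForm ℓ).re

/-- The length `∫ |dζ|` of the projection of a path to the `ζ`-plane. -/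
def projLength {x y : ℂ × ℂ} (γ : Path x y) : ℝ :=
  ∫ s in (0 : ℝ)..1, ‖derivWithin (fun s => (γ.extend s).1) (Set.Icc 0 1) s‖

namespace SpectralData

variable {N n : ℕ} {r : Option (Fin n) → ℕ} {T D : Type*}

/-- `ℓ` is a (piecewise smooth) closed path on the punctured curve at the parameter value `p`. -/
def IsClosedPathOn (S : SpectralData N n r T D) (p : T × D) {x : ℂ × ℂ} (ℓ : Path x x) : Prop :=
  IsPiecewiseC1 ℓ ∧ ∀ s, ℓ s ∈ S.curve p

/-- `ℓ` is a closed path carried along by the curves with `p ∈ W`: each `ℓ p` is a closed path on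
the punctured curve at `p`, and `ℓ p s` is jointly continuous in `p` and `s`. -/
def IsClosedPathFamily [TopologicalSpace T] [TopologicalSpace D] (S : SpectralData N n r T D)
    (W : Set (T × D)) {x : T × D → ℂ × ℂ} (ℓ : ∀ p, Path (x p) (x p)) : Prop :=
  (∀ p ∈ W, S.IsClosedPathOn p (ℓ p)) ∧
    ContinuousOn (fun q : (T × D) × I => ℓ q.1 q.2) (W ×ˢ Set.univ)

end SpectralData

end

section

open MeasureTheory Set Metric

/-! At a nonsingular point one of `∂F/∂ζ`, `∂F/∂μ` is nonzero, so nearby the curves `Γ_p` are graphs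
over a disc in one coordinate, holomorphic in that coordinate and `C¹` jointly with `p`. Integrating
along radial segments gives on such a chart a primitive `Φ` of `μ dζ`, differentiable jointly in `p`
and the point (`exists_parametric_primitive`, and `HasLocalChart.of_swap` when `ζ` is a function of
`μ`).

A closed path `ℓ₀` avoiding singular points is covered by finitely many charts, with differentiable
marked points `Y_i(p)` in the overlaps (`exists_chart_chain`). On a closed path of `Γ_p` close to
`ℓ₀` the integral is a sum of increments of the `Φ_i`. Sliding the division points to the `Y_i(p)`
changes nothing, because two primitives differ by a constant along a path in the overlap. The period
is therefore `∑ (Φ_i(p, Y_{i+1}(p)) - Φ_i(p, Y_i(p)))`, which is differentiable in `p` and does not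
involve the path (`exists_period_function`). Joining the marked points inside the charts produces a
nearby closed path (`exists_closedPath_near`).

At a singular point there is no chart, and continuity comes from integration by parts: `∮ μ' dζ' - ∮
μ dζ = ∮ (μ' - μ) dζ' - ∮ (ζ' - ζ) dμ` (`abs_periodJ_sub_le`). The right side is at most the uniform
distance times the `ζ`-length of the varying path plus the `μ`-length of the fixed one, so only the
former needs a uniform bound. -/

/-- The velocity `dγ/ds` of a path. -/
noncomputable def pathVelocity {x y : ℂ × ℂ} (γ : Path x y) (t : ℝ) : ℂ × ℂ :=
  derivWithin γ.extend (Icc 0 1) t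

/-! ### Integration of `μ dζ` along piecewise `C¹` paths. -/

namespace IsPiecewiseC1

variable {x y : ℂ × ℂ} {γ : Path x y}

theorem exists_countable_hasDerivAt (hγ : IsPiecewiseC1 γ) :
    ∃ Z : Set ℝ, Z.Countable ∧
      ∀ t ∈ Ioo (0 : ℝ) 1 \ Z, HasDerivAt γ.extend (pathVelocity γ t) t := by
  obtain ⟨m, s, hmono, h0, h1, hC⟩ := hγ
  refine ⟨range s, countable_range s, fun t ht => ?_⟩
  have hex : ∃ j, t < s j := ⟨m, by rw [h1]; exact ht.1.2⟩
  classical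
  -- The first break point beyond `t` and its predecessor bound the piece containing `t` in its
  -- interior.
  have hj := Nat.find_spec hex
  have hjm : Nat.find hex ≤ m := Nat.find_min' hex (by rw [h1]; exact ht.1.2)
  obtain ⟨i, hi⟩ : ∃ i, Nat.find hex = i + 1 := by
    refine Nat.exists_eq_succ_of_ne_zero fun h => ?_
    rw [h, h0] at hj
    exact lt_asymm hj ht.1.1
  have hlt : s i < t := by
    have := Nat.find_min hex (m := i) (by omega)
    exact lt_of_le_of_ne (not_lt.1 this) fun h => ht.2 ⟨i, h⟩
  rw [hi] at hj hjm
  have hd : DifferentiableAt ℝ γ.extend t :=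
    ((hC i (by omega)).differentiableOn one_ne_zero t ⟨hlt.le, hj.le⟩).differentiableAt
      (Icc_mem_nhds hlt hj)
  rw [pathVelocity, derivWithin_of_mem_nhds (Icc_mem_nhds ht.1.1 ht.1.2)]
  exact hd.hasDerivAt

theorem intervalIntegrable_velocity (hγ : IsPiecewiseC1 γ) :
    IntervalIntegrable (pathVelocity γ) volume 0 1 := by
  obtain ⟨m, s, hmono, h0, h1, hC⟩ := hγ
  rw [← h0, ← h1]
  refine IntervalIntegrable.trans_iterate fun i hi => ?_
  -- The break points are only weakly increasing, so a piece may be degenerate.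
  rcases (hmono (Nat.le_succ i)).eq_or_lt with h | h
  · rw [← Nat.succ_eq_add_one, ← h]
  have hc : ContinuousOn (derivWithin γ.extend (Icc (s i) (s (i + 1)))) (uIcc (s i) (s (i + 1))) := by
    rw [uIcc_of_le h.le]
    exact (hC i hi).continuousOn_derivWithin (uniqueDiffOn_Icc h) le_rfl
  refine hc.intervalIntegrable.congr_ae ?_
  rw [uIoc_of_le h.le, ← restrict_Ioo_eq_restrict_Ioc]
  filter_upwards [ae_restrict_mem measurableSet_Ioo] with t ht
  have h01 : t ∈ Ioo (0 : ℝ) 1 :=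
    ⟨(h0 ▸ hmono (Nat.zero_le i)).trans_lt ht.1, ht.2.trans_le (h1 ▸ hmono (by omega))⟩
  rw [pathVelocity, derivWithin_of_mem_nhds (Icc_mem_nhds h01.1 h01.2),
    derivWithin_of_mem_nhds (Icc_mem_nhds ht.1 ht.2)]

theorem intervalIntegrable_muForm (hγ : IsPiecewiseC1 γ) :
    IntervalIntegrable (fun t => muForm (γ.extend t) (pathVelocity γ t)) volume 0 1 := by
  have h := hγ.intervalIntegrable_velocity
  have h1 : IntervalIntegrable (fun t => (pathVelocity γ t).1) volume 0 1 := ⟨h.1.fst, h.2.fst⟩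
  have hc : Continuous fun t => (γ.extend t).2 := continuous_snd.comp γ.continuous_extend
  exact h1.continuousOn_mul hc.continuousOn

/-- The fundamental theorem of calculus off the countable set of break points. The differential of
`Φ` is prescribed only at points of the path: `μ dζ` is not closed on `ℂ × ℂ`, so a primitive can be
asked for only along a curve. -/
theorem integral_muForm_eq_sub (hγ : IsPiecewiseC1 γ) {a b : ℝ} (ha : 0 ≤ a) (hab : a ≤ b)
    (hb : b ≤ 1) {Φ : ℂ × ℂ → ℂ}
    (hΦ : ∀ t ∈ Icc a b, HasFDerivAt Φ (muForm (γ.extend t)) (γ.extend t)) :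
    ∫ t in a..b, muForm (γ.extend t) (pathVelocity γ t) =
      Φ (γ.extend b) - Φ (γ.extend a) := by
  obtain ⟨Z, hZ, hd⟩ := hγ.exists_countable_hasDerivAt
  refine integral_eq_of_hasDerivAt_off_countable_of_le (fun t => Φ (γ.extend t)) _ hab hZ ?_ ?_ ?_
  · exact fun t ht => ((hΦ t ht).continuousAt.comp
      (f := γ.extend) γ.continuous_extend.continuousAt).continuousWithinAt
  · intro t ht
    exact ((hΦ t (Ioo_subset_Icc_self ht.1)).restrictScalars ℝ).comp_hasDerivAt t
      (hd t ⟨Ioo_subset_Ioo ha hb ht.1, ht.2⟩)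
  · refine hγ.intervalIntegrable_muForm.mono_set ?_
    rw [uIcc_of_le hab, uIcc_of_le zero_le_one]
    exact Icc_subset_Icc ha hb

end IsPiecewiseC1

theorem curveIntegral_muForm {x y : ℂ × ℂ} (γ : Path x y) :
    curveIntegral muForm γ = ∫ t in (0 : ℝ)..1, muForm (γ.extend t) (pathVelocity γ t) := by
  simp only [curveIntegral_def, curveIntegralFun_def, pathVelocity]

theorem IsPiecewiseC1.projLength_eq {x y : ℂ × ℂ} {γ : Path x y} (hγ : IsPiecewiseC1 γ) :
    projLength γ = ∫ t in (0 : ℝ)..1, ‖(pathVelocity γ t).1‖ := by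
  obtain ⟨Z, hZ, hd⟩ := hγ.exists_countable_hasDerivAt
  refine intervalIntegral.integral_congr_ae_restrict ?_
  rw [uIoc_of_le zero_le_one, ← restrict_Ioo_eq_restrict_Ioc]
  filter_upwards [ae_restrict_mem measurableSet_Ioo,
    ae_restrict_of_ae (hZ.ae_notMem volume)] with t ht htZ
  have h : HasDerivAt (fun s => (γ.extend s).1) (pathVelocity γ t).1 t := (hd t ⟨ht, htZ⟩).fst
  rw [derivWithin_of_mem_nhds (Icc_mem_nhds ht.1 ht.2), h.deriv]

/-- Integration by parts moves the derivative off `ζ' - ζ`, whose velocity need not be small, onto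
the `μ` of the fixed path. The boundary term vanishes because both paths are closed. -/
theorem abs_periodJ_sub_le {x y : ℂ × ℂ} {γ : Path x x} {γ' : Path y y} (hγ : IsPiecewiseC1 γ)
    (hγ' : IsPiecewiseC1 γ') {ε : ℝ} (hε : ∀ s, dist (γ' s) (γ s) ≤ ε) :
    |periodJ γ' - periodJ γ| ≤
      ε * (projLength γ' + ∫ t in (0 : ℝ)..1, ‖(pathVelocity γ t).2‖) := by
  have hε' : ∀ t, ‖γ'.extend t - γ.extend t‖ ≤ ε := fun t => by
    rw [← dist_eq_norm]; exact hε _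
  have hv := hγ.intervalIntegrable_velocity
  have hv' := hγ'.intervalIntegrable_velocity
  have hv1 : IntervalIntegrable (fun t => (pathVelocity γ t).1) volume 0 1 := ⟨hv.1.fst, hv.2.fst⟩
  have hv2 : IntervalIntegrable (fun t => (pathVelocity γ t).2) volume 0 1 := ⟨hv.1.snd, hv.2.snd⟩
  have hv1' : IntervalIntegrable (fun t => (pathVelocity γ' t).1) volume 0 1 :=
    ⟨hv'.1.fst, hv'.2.fst⟩
  have hc := γ.continuous_extend
  have hc' := γ'.continuous_extend
  obtain ⟨Z, hZ, hd⟩ := hγ.exists_countable_hasDerivAt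
  obtain ⟨Z', hZ', hd'⟩ := hγ'.exists_countable_hasDerivAt
  have hA : IntervalIntegrable (fun t => ((γ'.extend t).2 - (γ.extend t).2) *
      (pathVelocity γ' t).1) volume 0 1 := hv1'.continuousOn_mul (by fun_prop)
  have hB : IntervalIntegrable (fun t => ((γ'.extend t).1 - (γ.extend t).1) *
      (pathVelocity γ t).2) volume 0 1 := hv2.continuousOn_mul (by fun_prop)
  have hC : IntervalIntegrable (fun t => (γ.extend t).2 *
      ((pathVelocity γ' t).1 - (pathVelocity γ t).1)) volume 0 1 :=
    (hv1'.sub hv1).continuousOn_mul (by fun_prop)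
  have hparts : ∫ t in (0 : ℝ)..1, ((γ.extend t).2 *
      ((pathVelocity γ' t).1 - (pathVelocity γ t).1) +
      ((γ'.extend t).1 - (γ.extend t).1) * (pathVelocity γ t).2) = 0 := by
    rw [integral_eq_of_hasDerivAt_off_countable_of_le
      (fun t => (γ.extend t).2 * ((γ'.extend t).1 - (γ.extend t).1)) _ zero_le_one
      (hZ.union hZ') (by fun_prop) ?_ (hC.add hB)]
    · simp
    · intro t ht
      have h := hd t ⟨ht.1, fun h => ht.2 (Or.inl h)⟩
      have h' := hd' t ⟨ht.1, fun h => ht.2 (Or.inr h)⟩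
      have h1 : HasDerivAt (fun s => (γ.extend s).1) (pathVelocity γ t).1 t := h.fst
      have h2 : HasDerivAt (fun s => (γ.extend s).2) (pathVelocity γ t).2 t := h.snd
      have h3 : HasDerivAt (fun s => (γ'.extend s).1) (pathVelocity γ' t).1 t := h'.fst
      refine (h2.fun_mul (h3.fun_sub h1)).congr_deriv ?_
      ring
  have hdiff : curveIntegral muForm γ' - curveIntegral muForm γ =
      (∫ t in (0 : ℝ)..1, ((γ'.extend t).2 - (γ.extend t).2) * (pathVelocity γ' t).1) -
      ∫ t in (0 : ℝ)..1, ((γ'.extend t).1 - (γ.extend t).1) * (pathVelocity γ t).2 := by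
    have hsum : curveIntegral muForm γ' - curveIntegral muForm γ =
        (∫ t in (0 : ℝ)..1, ((γ'.extend t).2 - (γ.extend t).2) * (pathVelocity γ' t).1) +
        ∫ t in (0 : ℝ)..1, (γ.extend t).2 *
          ((pathVelocity γ' t).1 - (pathVelocity γ t).1) := by
      rw [curveIntegral_muForm, curveIntegral_muForm, ← intervalIntegral.integral_sub
        hγ'.intervalIntegrable_muForm hγ.intervalIntegrable_muForm,
        ← intervalIntegral.integral_add hA hC]
      refine intervalIntegral.integral_congr fun t _ => ?_
      simp only [muForm, smul_apply, ContinuousLinearMap.coe_fst', smul_eq_mul]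
      ring
    rw [intervalIntegral.integral_add hC hB] at hparts
    linear_combination hsum + hparts
  have hA' : ‖∫ t in (0 : ℝ)..1, ((γ'.extend t).2 - (γ.extend t).2) * (pathVelocity γ' t).1‖ ≤
      ε * projLength γ' := by
    rw [hγ'.projLength_eq, ← intervalIntegral.integral_const_mul]
    refine intervalIntegral.norm_integral_le_of_norm_le zero_le_one
      (Filter.Eventually.of_forall fun t _ => ?_) (hv1'.norm.const_mul ε)
    rw [norm_mul]
    gcongr
    exact (norm_snd_le (γ'.extend t - γ.extend t)).trans (hε' t)
  have hB' : ‖∫ t in (0 : ℝ)..1, ((γ'.extend t).1 - (γ.extend t).1) * (pathVelocity γ t).2‖ ≤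
      ε * ∫ t in (0 : ℝ)..1, ‖(pathVelocity γ t).2‖ := by
    rw [← intervalIntegral.integral_const_mul]
    refine intervalIntegral.norm_integral_le_of_norm_le zero_le_one
      (Filter.Eventually.of_forall fun t _ => ?_) (hv2.norm.const_mul ε)
    rw [norm_mul]
    gcongr
    exact (norm_fst_le (γ'.extend t - γ.extend t)).trans (hε' t)
  rw [periodJ, periodJ, ← Complex.sub_re, mul_add]
  exact (Complex.abs_re_le_norm _).trans ((congrArg norm hdiff).trans_le
    ((norm_sub_le _ _).trans (add_le_add hA' hB')))

/-! ### Implicit functions, holomorphic in one variable and `C¹` in parameters. -/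

section ImplicitGraph

variable {E : Type*} [NormedAddCommGroup E] [NormedSpace ℝ E]

theorem fderiv_apply_inr_eq_deriv_mul {H : (E × ℂ) × ℂ → ℂ} {q : (E × ℂ) × ℂ}
    (hH : DifferentiableAt ℝ H q) (hb : DifferentiableAt ℂ (fun b => H (q.1, b)) q.2) (v : ℂ) :
    fderiv ℝ H q (0, v) = deriv (fun b => H (q.1, b)) q.2 * v := by
  have h1 : HasFDerivAt (fun b : ℂ => (q.1, b)) (ContinuousLinearMap.inr ℝ (E × ℂ) ℂ) q.2 :=
    hasFDerivAt_prodMk_right q.1 q.2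
  have h2 : HasFDerivAt (fun b => H (q.1, b)) _ q.2 :=
    HasFDerivAt.comp q.2 (show HasFDerivAt H (fderiv ℝ H q) (q.1, q.2) from hH.hasFDerivAt) h1
  have h3 := hb.hasDerivAt.hasFDerivAt.restrictScalars ℝ
  have := congrArg (fun L : ℂ →L[ℝ] ℂ => L v) (h2.unique h3)
  simpa [mul_comm] using this

theorem fderiv_apply_inl_inr_eq_deriv_mul {H : (E × ℂ) × ℂ → ℂ} {q : (E × ℂ) × ℂ}
    (hH : DifferentiableAt ℝ H q)
    (ha : DifferentiableAt ℂ (fun a => H ((q.1.1, a), q.2)) q.1.2) (v : ℂ) :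
    fderiv ℝ H q ((0, v), 0) = deriv (fun a => H ((q.1.1, a), q.2)) q.1.2 * v := by
  have h1 : HasFDerivAt (fun a : ℂ => (((q.1.1, a), q.2) : (E × ℂ) × ℂ))
      ((ContinuousLinearMap.inl ℝ (E × ℂ) ℂ).comp (ContinuousLinearMap.inr ℝ E ℂ)) q.1.2 :=
    HasFDerivAt.comp (g := fun z : E × ℂ => (z, q.2)) q.1.2
      (hasFDerivAt_prodMk_left (q.1.1, q.1.2) q.2) (hasFDerivAt_prodMk_right q.1.1 q.1.2)
  have h2 : HasFDerivAt (fun a => H ((q.1.1, a), q.2)) _ q.1.2 :=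
    HasFDerivAt.comp q.1.2
      (show HasFDerivAt H (fderiv ℝ H q) ((q.1.1, q.1.2), q.2) from hH.hasFDerivAt) h1
  have h3 := ha.hasDerivAt.hasFDerivAt.restrictScalars ℝ
  have := congrArg (fun L : ℂ →L[ℝ] ℂ => L v) (h2.unique h3)
  simpa [mul_comm] using this

/-- A real differentiable solution `a ↦ g (p, a)` of an equation `H = 0` that is holomorphic in
both complex variables is holomorphic. -/
theorem differentiableAt_complex_of_implicit {H : (E × ℂ) × ℂ → ℂ} {g : E × ℂ → ℂ} {p : E} {a : ℂ}
    (hH : DifferentiableAt ℝ H ((p, a), g (p, a)))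
    (ha : DifferentiableAt ℂ (fun z => H ((p, z), g (p, a))) a)
    (hb : DifferentiableAt ℂ (fun z => H ((p, a), z)) (g (p, a)))
    (hne : fderiv ℝ H ((p, a), g (p, a)) (0, 1) ≠ 0)
    (hg : DifferentiableAt ℝ g (p, a)) (hzero : ∀ᶠ z in 𝓝 a, H ((p, z), g (p, z)) = 0) :
    DifferentiableAt ℂ (fun z => g (p, z)) a := by
  set q : (E × ℂ) × ℂ := ((p, a), g (p, a)) with hq
  have hB := fderiv_apply_inr_eq_deriv_mul (q := q) hH hb
  have hA := fderiv_apply_inl_inr_eq_deriv_mul (q := q) hH ha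
  set A := deriv (fun z => H ((q.1.1, z), q.2)) q.1.2
  set B := deriv (fun z => H (q.1, z)) q.2
  have hB0 : B ≠ 0 := fun h => hne (by rw [hB, h, zero_mul])
  have h1 : HasFDerivAt (fun z : ℂ => (p, z)) (ContinuousLinearMap.inr ℝ E ℂ) a :=
    hasFDerivAt_prodMk_right p a
  have hg' : HasFDerivAt (fun z => g (p, z)) _ a :=
    HasFDerivAt.comp a (show HasFDerivAt g (fderiv ℝ g (p, a)) (p, a) from hg.hasFDerivAt) h1
  set G := (fderiv ℝ g (p, a)).comp (ContinuousLinearMap.inr ℝ E ℂ)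
  have h2 : HasFDerivAt (fun z : ℂ => ((p, z), g (p, z)))
      ((ContinuousLinearMap.inr ℝ E ℂ).prod G) a := h1.prodMk hg'
  have h3 : HasFDerivAt (fun z => H ((p, z), g (p, z))) _ a :=
    HasFDerivAt.comp a (show HasFDerivAt H (fderiv ℝ H q) _ from hH.hasFDerivAt) h2
  have h4 : HasFDerivAt (fun z => H ((p, z), g (p, z))) (0 : ℂ →L[ℝ] ℂ) a :=
    (hasFDerivAt_const (0 : ℂ) a).congr_of_eventuallyEq hzero
  -- Differentiating `H = 0` along the graph forces the real derivative `G` to be multiplication by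
  -- `-A / B`, hence complex linear.
  have h5 : ∀ u : ℂ, A * u + B * G u = 0 := fun u => by
    have := congrArg (fun L : ℂ →L[ℝ] ℂ => L u) (h3.unique h4)
    have hs : (((0, u), G u) : (E × ℂ) × ℂ) = ((0, u), 0) + (0, G u) := by simp
    simp only [ContinuousLinearMap.comp_apply, ContinuousLinearMap.prod_apply,
      ContinuousLinearMap.inr_apply, zero_apply] at this
    rwa [hs, map_add, hA, hB] at this
  refine (hasFDerivAt_of_restrictScalars ℝ hg'
    (f' := ContinuousLinearMap.toSpanSingleton ℂ (-A / B)) ?_).differentiableAt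
  ext u
  have := h5 u
  have : G u = u * (-A / B) := by
    field_simp
    linear_combination this
  simpa using this.symm

/-- The implicit function theorem for one holomorphic equation that depends in a continuously
differentiable way on parameters. -/
theorem exists_implicit_graph [CompleteSpace E] {U : Set ((E × ℂ) × ℂ)} (hU : IsOpen U)
    {H : (E × ℂ) × ℂ → ℂ} (hH : ContDiffOn ℝ 1 H U)
    (hHa : ∀ q ∈ U, DifferentiableAt ℂ (fun a => H ((q.1.1, a), q.2)) q.1.2)
    (hHb : ∀ q ∈ U, DifferentiableAt ℂ (fun b => H (q.1, b)) q.2)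
    {p₀ : E} {a₀ b₀ : ℂ} (hq₀ : ((p₀, a₀), b₀) ∈ U) (h0 : H ((p₀, a₀), b₀) = 0)
    (hne : deriv (fun b => H ((p₀, a₀), b)) b₀ ≠ 0) {η : ℝ} (hη : 0 < η) :
    ∃ g : E × ℂ → ℂ, ∃ δ > 0, δ ≤ η ∧ ∃ V : Set E, IsOpen V ∧ p₀ ∈ V ∧ g (p₀, a₀) = b₀ ∧
      ContDiffOn ℝ 1 g (V ×ˢ ball a₀ δ) ∧
      (∀ p ∈ V, DifferentiableOn ℂ (fun a => g (p, a)) (ball a₀ δ)) ∧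
      (∀ p ∈ V, ∀ a ∈ ball a₀ δ, ((p, a), g (p, a)) ∈ U ∧ H ((p, a), g (p, a)) = 0 ∧
        g (p, a) ∈ ball b₀ η) ∧
      ∀ p ∈ V, ∀ a ∈ ball a₀ δ, ∀ b ∈ ball b₀ δ, H ((p, a), b) = 0 → b = g (p, a) := by
  have hd : ∀ q ∈ U, DifferentiableAt ℝ H q := fun q hq =>
    (hH.differentiableOn one_ne_zero).differentiableAt (hU.mem_nhds hq)
  have cdf : ContDiffAt ℝ 1 H ((p₀, a₀), b₀) := hH.contDiffAt (hU.mem_nhds hq₀)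
  have hinr := fderiv_apply_inr_eq_deriv_mul (hd _ hq₀) (hHb _ hq₀)
  -- The real partial derivative is multiplication by a nonzero complex number, hence an
  -- isomorphism.
  have hinv : (fderiv ℝ H ((p₀, a₀), b₀) ∘L .inr ℝ (E × ℂ) ℂ).IsInvertible := by
    refine ⟨(ContinuousLinearEquiv.unitsEquivAut ℂ (Units.mk0 _ hne)).restrictScalars ℝ, ?_⟩
    ext v
    simp [hinr, mul_comm]
  have hone : (1 : WithTop ℕ∞) ≠ 0 := one_ne_zero
  set g := cdf.implicitFunction hone hinv
  have hg0 : g (p₀, a₀) = b₀ := cdf.implicitFunction_apply_self hone hinv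
  have hgC : ContDiffAt ℝ 1 g (p₀, a₀) := cdf.contDiffAt_implicitFunction hone hinv
  have hgraph : Filter.Tendsto (fun z : E × ℂ => (z, g z)) (𝓝 (p₀, a₀)) (𝓝 ((p₀, a₀), b₀)) := by
    have := (continuousAt_id.prodMk hgC.continuousAt : ContinuousAt (fun z => (z, g z)) (p₀, a₀))
    simpa [ContinuousAt, hg0] using this
  have hfne : ∀ᶠ q in 𝓝 ((p₀, a₀), b₀), fderiv ℝ H q (0, 1) ≠ 0 := by
    have hc : ContinuousAt (fun q => fderiv ℝ H q (0, 1)) ((p₀, a₀), b₀) :=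
      (cdf.continuousAt_fderiv hone).clm_apply continuousAt_const
    refine hc.eventually_ne ?_
    rw [hinr, mul_one]
    exact hne
  have hev : ∀ᶠ z in 𝓝 (p₀, a₀), ContDiffAt ℝ 1 g z ∧ (z, g z) ∈ U ∧ H (z, g z) = 0 ∧
      g z ∈ ball b₀ η ∧ fderiv ℝ H (z, g z) (0, 1) ≠ 0 := by
    filter_upwards [hgC.eventually (by simp), hgraph.eventually (hU.mem_nhds hq₀),
      cdf.eventually_apply_implicitFunction hone hinv, hgC.continuousAt.eventually
        (show ball b₀ η ∈ 𝓝 (g (p₀, a₀)) from hg0.symm ▸ ball_mem_nhds b₀ hη), hgraph.eventually hfne] with z h1 h2 h3 h4 h5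
    exact ⟨h1, h2, h3.trans h0, h4, h5⟩
  have huniq := cdf.eventually_apply_eq_iff_implicitFunction hone hinv
  obtain ⟨S, hS, R, hR, hSR⟩ := mem_nhds_prod_iff.1 huniq
  obtain ⟨V', hV', A', hA', hVA⟩ := mem_nhds_prod_iff.1 (Filter.inter_mem hS hev)
  obtain ⟨V, hVV', hV, hpV⟩ := _root_.mem_nhds_iff.1 hV'
  obtain ⟨δ₁, hδ₁, hA⟩ := Metric.mem_nhds_iff.1 hA'
  obtain ⟨δ₂, hδ₂, hB⟩ := Metric.mem_nhds_iff.1 hR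
  set δ := min η (min δ₁ δ₂)
  have hδ1 : δ ≤ δ₁ := (min_le_right _ _).trans (min_le_left _ _)
  have hδ2 : δ ≤ δ₂ := (min_le_right _ _).trans (min_le_right _ _)
  have key : ∀ p ∈ V, ∀ a ∈ ball a₀ δ, (p, a) ∈ S ∩ {z | ContDiffAt ℝ 1 g z ∧ (z, g z) ∈ U ∧
      H (z, g z) = 0 ∧ g z ∈ ball b₀ η ∧ fderiv ℝ H (z, g z) (0, 1) ≠ 0} := fun p hp a ha =>
    hVA ⟨hVV' hp, hA (ball_subset_ball hδ1 ha)⟩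
  refine ⟨g, δ, by positivity, min_le_left _ _, V, hV, hpV, hg0, ?_, ?_, ?_, ?_⟩
  · exact fun z hz => (key z.1 hz.1 z.2 hz.2).2.1.contDiffWithinAt
  · intro p hp a ha
    obtain ⟨-, h1, h2, h3, h4, h5⟩ := key p hp a ha
    refine (differentiableAt_complex_of_implicit (hd _ h2) (hHa _ h2) (hHb _ h2) h5
      (h1.differentiableAt hone) ?_).differentiableWithinAt
    filter_upwards [isOpen_ball.mem_nhds ha] with z hz
    exact (key p hp z hz).2.2.2.1
  · intro p hp a ha
    obtain ⟨-, -, h2, h3, h4, -⟩ := key p hp a ha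
    exact ⟨h2, h3, h4⟩
  · intro p hp a ha b hb h
    have := @hSR ((p, a), b) ⟨(key p hp a ha).1, hB (ball_subset_ball hδ2 hb)⟩
    exact (this.1 (h.trans h0.symm)).symm

end ImplicitGraph

/-! ### Primitives depending on parameters. -/

section ParametricPrimitive

variable {X : Type*} [NormedAddCommGroup X] [NormedSpace ℝ X]

/-- Differentiation under the integral sign. The derivative is bounded on the compact segment over
`x₀`, and the tube lemma extends the bound, enlarged by `1`, to a neighbourhood of `x₀` uniformly in
`t`. -/
theorem differentiableAt_integral_of_contDiffOn {W : Set (X × ℝ)} (hW : IsOpen W)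
    {G : X × ℝ → ℂ} (hG : ContDiffOn ℝ 1 G W) {x₀ : X} (hx₀ : ∀ t ∈ Icc (0 : ℝ) 1, (x₀, t) ∈ W) :
    DifferentiableAt ℝ (fun x => ∫ t in (0 : ℝ)..1, G (x, t)) x₀ := by
  have hfc : ContinuousOn (fderiv ℝ G) W := hG.continuousOn_fderiv_of_isOpen hW le_rfl
  have hpair : Continuous fun t : ℝ => (x₀, t) := by fun_prop
  obtain ⟨C, hC⟩ := isCompact_Icc.exists_bound_of_continuousOn (hfc.comp hpair.continuousOn hx₀)
  have hW' : IsOpen (W ∩ (fun q => ‖fderiv ℝ G q‖) ⁻¹' Iio (C + 1)) :=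
    hfc.norm.isOpen_inter_preimage hW isOpen_Iio
  obtain ⟨u, v, hu, -, hxu, hv, huv⟩ := generalized_tube_lemma (isCompact_singleton (x := x₀))
    (isCompact_Icc (a := (0 : ℝ)) (b := 1)) hW' (by
      rintro ⟨y, t⟩ ⟨hy, ht⟩
      obtain rfl : y = x₀ := hy
      exact ⟨hx₀ t ht, (hC t ht).trans_lt (lt_add_one C)⟩)
  have hmem : ∀ y ∈ u, ∀ t ∈ Icc (0 : ℝ) 1, (y, t) ∈ W ∧ ‖fderiv ℝ G (y, t)‖ < C + 1 :=
    fun y hy t ht => huv ⟨hy, hv ht⟩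
  have hxu' : x₀ ∈ u := hxu rfl
  have hcont : ∀ y ∈ u, ContinuousOn (fun t => G (y, t)) (Icc 0 1) := fun y hy =>
    hG.continuousOn.comp (by fun_prop) fun t ht => (hmem y hy t ht).1
  have hI : uIoc (0 : ℝ) 1 ⊆ Icc 0 1 := by
    rw [uIoc_of_le zero_le_one]
    exact Ioc_subset_Icc_self
  refine (intervalIntegral.hasFDerivAt_integral_of_dominated_of_fderiv_le (𝕜 := ℝ)
    (F := fun x t => G (x, t)) (s := u) (bound := fun _ => C + 1)
    (F' := fun x t => (fderiv ℝ G (x, t)).comp (ContinuousLinearMap.inl ℝ X ℝ))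
    (hu.mem_nhds hxu') ?_ ?_ ?_ ?_ ?_ ?_).differentiableAt
  · filter_upwards [hu.mem_nhds hxu'] with y hy
    exact ((hcont y hy).mono hI).aestronglyMeasurable measurableSet_uIoc
  · exact ContinuousOn.intervalIntegrable (by
      rw [uIcc_of_le zero_le_one]
      exact hcont x₀ hxu')
  · refine ContinuousOn.aestronglyMeasurable ?_ measurableSet_uIoc
    refine ContinuousOn.clm_comp ?_ continuousOn_const
    exact hfc.comp hpair.continuousOn fun t ht => hx₀ t (hI ht)
  · refine Filter.Eventually.of_forall fun t ht y hy => ?_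
    refine (ContinuousLinearMap.opNorm_comp_le _ _).trans ?_
    have h1 := (hmem y hy t (hI ht)).2.le
    have h2 := ContinuousLinearMap.norm_inl_le_one ℝ X ℝ
    nlinarith [norm_nonneg (fderiv ℝ G (y, t)), norm_nonneg (ContinuousLinearMap.inl ℝ X ℝ)]
  · exact intervalIntegrable_const
  · refine Filter.Eventually.of_forall fun t ht y hy => ?_
    have h1 : HasFDerivAt G (fderiv ℝ G (y, t)) (y, t) :=
      ((hG.differentiableOn one_ne_zero).differentiableAt
        (hW.mem_nhds (hmem y hy t (hI ht)).1)).hasFDerivAt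
    exact HasFDerivAt.comp (g := G) y h1 (hasFDerivAt_prodMk_left y t)

/-- Primitives of holomorphic functions on a disc that depend on parameters. -/
theorem exists_parametric_primitive {V : Set X} (hV : IsOpen V) {a₀ : ℂ} {δ : ℝ} (hδ : 0 < δ)
    {g : X × ℂ → ℂ} (hg : ContDiffOn ℝ 1 g (V ×ˢ ball a₀ δ))
    (hol : ∀ p ∈ V, DifferentiableOn ℂ (fun a => g (p, a)) (ball a₀ δ)) :
    ∃ Ψ : X × ℂ → ℂ, DifferentiableOn ℝ Ψ (V ×ˢ ball a₀ δ) ∧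
      ∀ p ∈ V, ∀ a ∈ ball a₀ δ, HasDerivAt (fun z => Ψ (p, z)) (g (p, a)) a := by
  have hseg : ∀ z ∈ ball a₀ δ, ∀ t ∈ Icc (0 : ℝ) 1, a₀ + t • (z - a₀) ∈ ball a₀ δ :=
    fun z hz t ht => (convex_ball a₀ δ).add_smul_sub_mem (mem_ball_self hδ) hz ht
  refine ⟨fun z => ∫ t in (0 : ℝ)..1, g (z.1, a₀ + t • (z.2 - a₀)) * (z.2 - a₀), ?_, ?_⟩
  · intro z hz
    let k : (X × ℂ) × ℝ → X × ℂ := fun q => (q.1.1, a₀ + q.2 • (q.1.2 - a₀))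
    have hk : ContDiff ℝ 1 k := by fun_prop
    have hW : IsOpen (k ⁻¹' (V ×ˢ ball a₀ δ)) := (hV.prod isOpen_ball).preimage hk.continuous
    have hG : ContDiffOn ℝ 1 (fun q : (X × ℂ) × ℝ => g (k q) * (q.1.2 - a₀))
        (k ⁻¹' (V ×ˢ ball a₀ δ)) :=
      (hg.comp hk.contDiffOn fun q hq => hq).mul (by fun_prop)
    exact (differentiableAt_integral_of_contDiffOn hW hG (x₀ := z)
      fun t ht => ⟨hz.1, hseg _ hz.2 t ht⟩).differentiableWithinAt
  · intro p hp a ha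
    -- For fixed `p` a primitive `G` exists on the disc, and the radial integral equals `G z - G
    -- a₀`.
    obtain ⟨G, hG⟩ := (hol p hp).isExactOn_ball
    refine ((hG a ha).sub_const (G a₀)).congr_of_eventuallyEq ?_
    filter_upwards [isOpen_ball.mem_nhds ha] with z hz
    have hderiv : ∀ t ∈ uIcc (0 : ℝ) 1, HasDerivAt (fun t : ℝ => G (a₀ + t • (z - a₀)))
        (g (p, a₀ + t • (z - a₀)) * (z - a₀)) t := by
      intro t ht
      rw [uIcc_of_le zero_le_one] at ht
      have h1 : HasDerivAt (fun t : ℝ => a₀ + t • (z - a₀)) (z - a₀) t := by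
        simpa using ((hasDerivAt_id t).smul_const (z - a₀)).const_add a₀
      exact (hG _ (hseg z hz t ht)).comp t h1
    have hcont : ContinuousOn (fun t : ℝ => g (p, a₀ + t • (z - a₀)) * (z - a₀)) (uIcc 0 1) := by
      rw [uIcc_of_le zero_le_one]
      refine ContinuousOn.mul ?_ continuousOn_const
      exact hg.continuousOn.comp (by fun_prop) fun t ht => ⟨hp, hseg z hz t ht⟩
    have := intervalIntegral.integral_eq_sub_of_hasDerivAt hderiv hcont.intervalIntegrable
    simpa using this

end ParametricPrimitive

/-! ### Local charts of the family of curves. -/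

section LocalChart

variable {E : Type*} [NormedAddCommGroup E] [NormedSpace ℝ E]

/-- Near `x`, the curves `Z p` with `p` near `p₀` are discs with a differentiable section, on which
`μ dζ` has a primitive that is differentiable in `p`. -/
def HasLocalChart (Z : E → Set (ℂ × ℂ)) (p₀ : E) (x : ℂ × ℂ) : Prop :=
  ∀ η > 0, ∃ δ > 0, δ ≤ η ∧ ∃ V : Set E, IsOpen V ∧ p₀ ∈ V ∧
    ∃ (Φ : E × (ℂ × ℂ) → ℂ) (Y : E → ℂ × ℂ),
      DifferentiableOn ℝ Φ (V ×ˢ ball x δ) ∧ DifferentiableOn ℝ Y V ∧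
      (∀ p ∈ V, Y p ∈ Z p ∩ ball x δ) ∧
      (∀ p ∈ V, ∀ y ∈ Z p ∩ ball x δ, HasFDerivAt (fun z => Φ (p, z)) (muForm y) y) ∧
      ∀ p ∈ V, ∀ y ∈ Z p ∩ ball x δ, ∀ y' ∈ Z p ∩ ball x δ, ∃ γ : ℝ → ℂ × ℂ,
        ContDiffOn ℝ 1 γ (Icc 0 1) ∧ γ 0 = y ∧ γ 1 = y' ∧ MapsTo γ (Icc 0 1) (Z p ∩ ball x η)

theorem swap_mem_ball {x y : ℂ × ℂ} {δ : ℝ} : y.swap ∈ ball x.swap δ ↔ y ∈ ball x δ := by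
  simp [Prod.dist_eq, and_comm]

/-- Since `d(ζμ) = μ dζ + ζ dμ`, a primitive of `ζ dμ` subtracted from `ζμ` is a primitive of `μ
dζ`. -/
theorem HasLocalChart.of_swap {Z : E → Set (ℂ × ℂ)} {p₀ : E} {x : ℂ × ℂ}
    (h : HasLocalChart (fun p => Prod.swap ⁻¹' Z p) p₀ x.swap) : HasLocalChart Z p₀ x := by
  intro η hη
  obtain ⟨δ, hδ, hδη, V, hV, hpV, Φ, Y, hΦ, hY, hYmem, hprim, hconn⟩ := h η hη
  have hswap : ContDiff ℝ 1 (Prod.swap : ℂ × ℂ → ℂ × ℂ) := contDiff_snd.prodMk contDiff_fst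
  have hmem : ∀ p, ∀ y, y ∈ Z p ∩ ball x δ → y.swap ∈ Prod.swap ⁻¹' Z p ∩ ball x.swap δ :=
    fun p y hy => ⟨by simpa using hy.1, swap_mem_ball.2 hy.2⟩
  refine ⟨δ, hδ, hδη, V, hV, hpV, fun q => q.2.1 * q.2.2 - Φ (q.1, q.2.swap),
    fun p => (Y p).swap, ?_, ?_, ?_, ?_, ?_⟩
  · refine DifferentiableOn.sub (by fun_prop) (hΦ.comp ?_ fun q hq => ⟨hq.1, swap_mem_ball.2 hq.2⟩)
    exact (differentiable_fst.prodMk ((hswap.differentiable one_ne_zero).comp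
      differentiable_snd)).differentiableOn
  · exact (hswap.differentiable one_ne_zero).comp_differentiableOn hY
  · exact fun p hp => ⟨(hYmem p hp).1, by
      rw [← swap_mem_ball, Prod.swap_swap]; exact (hYmem p hp).2⟩
  · intro p hp y hy
    have h1 := hprim p hp _ (hmem p y hy)
    have h2 : HasFDerivAt (Prod.swap : ℂ × ℂ → ℂ × ℂ)
      ((ContinuousLinearMap.snd ℂ ℂ ℂ).prod (ContinuousLinearMap.fst ℂ ℂ ℂ)) y :=
      hasFDerivAt_snd.prodMk hasFDerivAt_fst
    have h3 := ((hasFDerivAt_fst (𝕜 := ℂ) (p := y)).mul hasFDerivAt_snd).sub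
      (HasFDerivAt.comp (g := fun z => Φ (p, z)) y h1 h2)
    refine h3.congr_fderiv ?_
    ext <;> simp [muForm]
  · intro p hp y hy y' hy'
    obtain ⟨γ, hγ, h0, h1, hmaps⟩ := hconn p hp _ (hmem p y hy) _ (hmem p y' hy')
    refine ⟨fun t => (γ t).swap, hswap.comp_contDiffOn hγ, by simp [h0], by simp [h1],
      fun t ht => ⟨(hmaps ht).1, ?_⟩⟩
    rw [← swap_mem_ball, Prod.swap_swap]
    exact (hmaps ht).2

theorem hasLocalChart_of_deriv_ne_zero [CompleteSpace E] {U : Set ((E × ℂ) × ℂ)} (hU : IsOpen U)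
    {H : (E × ℂ) × ℂ → ℂ} (hH : ContDiffOn ℝ 1 H U)
    (hHa : ∀ q ∈ U, DifferentiableAt ℂ (fun a => H ((q.1.1, a), q.2)) q.1.2)
    (hHb : ∀ q ∈ U, DifferentiableAt ℂ (fun b => H (q.1, b)) q.2)
    {Z : E → Set (ℂ × ℂ)} {p₀ : E} {x : ℂ × ℂ} (hxU : ((p₀, x.1), x.2) ∈ U) (hx : x ∈ Z p₀)
    (hZ : ∀ p y, ((p, y.1), y.2) ∈ U → (y ∈ Z p ↔ H ((p, y.1), y.2) = 0))
    (hne : deriv (fun b => H ((p₀, x.1), b)) x.2 ≠ 0) : HasLocalChart Z p₀ x := by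
  intro η hη
  obtain ⟨r, hr, hrU⟩ : ∃ r > 0, ball ((p₀, x.1), x.2) r ⊆ U :=
    Metric.isOpen_iff.1 hU _ hxU
  obtain ⟨g, δ, hδ, hδη, V, hV, hpV, hg0, hgC, hghol, hgmem, hguniq⟩ :=
    exists_implicit_graph hU hH hHa hHb hxU ((hZ p₀ x hxU).1 hx) hne (lt_min hη hr)
  obtain ⟨Ψ, hΨ, hΨd⟩ := exists_parametric_primitive hV hδ hgC hghol
  have hY : DifferentiableOn ℝ (fun p => (x.1, g (p, x.1))) V :=
    (differentiableOn_const _).prodMk ((hgC.differentiableOn one_ne_zero).comp (by fun_prop)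
      fun p hp => ⟨hp, mem_ball_self hδ⟩)
  -- The section is the point of the graph over the centre. The parameter set is shrunk to keep it
  -- in the `δ`-ball, as the graph is only known to lie in the `η`-ball.
  have hYball : IsOpen (V ∩ (fun p => (x.1, g (p, x.1))) ⁻¹' ball x δ) :=
    hY.continuousOn.isOpen_inter_preimage hV isOpen_ball
  have hgraph : ∀ p ∈ V, ∀ a ∈ ball x.1 δ, (a, g (p, a)) ∈ Z p ∩ ball x η := fun p hp a ha => by
    obtain ⟨h1, h2, h3⟩ := hgmem p hp a ha
    exact ⟨(hZ p (a, g (p, a)) h1).2 h2, by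
      rw [mem_ball, Prod.dist_eq, max_lt_iff]
      exact ⟨ha.trans_le (hδη.trans (min_le_left _ _)), h3.trans_le (min_le_left _ _)⟩⟩
  have hZU : ∀ p ∈ ball p₀ r, ∀ y ∈ ball x δ, ((p, y.1), y.2) ∈ U := fun p hp y hy => by
    rw [mem_ball, Prod.dist_eq, max_lt_iff] at hy
    refine hrU ?_
    rw [mem_ball, Prod.dist_eq, Prod.dist_eq, max_lt_iff, max_lt_iff]
    have hδr : δ ≤ r := hδη.trans (min_le_right _ _)
    exact ⟨⟨hp, hy.1.trans_le hδr⟩, hy.2.trans_le hδr⟩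
  have hygraph : ∀ p ∈ V ∩ ball p₀ r, ∀ y ∈ Z p ∩ ball x δ,
      y.1 ∈ ball x.1 δ ∧ y.2 = g (p, y.1) := fun p hp y hy => by
    have hU' := hZU p hp.2 y hy.2
    have hy2 := hy.2
    rw [mem_ball, Prod.dist_eq, max_lt_iff] at hy2
    exact ⟨hy2.1, hguniq p hp.1 y.1 hy2.1 y.2 hy2.2 ((hZ p y hU').1 hy.1)⟩
  refine ⟨δ, hδ, hδη.trans (min_le_left _ _),
    V ∩ (fun p => (x.1, g (p, x.1))) ⁻¹' ball x δ ∩ ball p₀ r, hYball.inter isOpen_ball,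
    ⟨⟨hpV, ?_⟩, mem_ball_self hr⟩, fun q => Ψ (q.1, q.2.1),
    fun p => (x.1, g (p, x.1)), ?_, ?_, ?_, ?_, ?_⟩
  · rw [mem_preimage, hg0]
    exact mem_ball_self hδ
  · refine hΨ.comp (by fun_prop) fun q hq => ⟨hq.1.1.1, ?_⟩
    have := hq.2
    rw [mem_ball, Prod.dist_eq, max_lt_iff] at this
    exact this.1
  · exact hY.mono fun p hp => hp.1.1
  · exact fun p hp => ⟨(hgraph p hp.1.1 x.1 (mem_ball_self hδ)).1, hp.1.2⟩
  · intro p hp y hy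
    obtain ⟨h1, h2⟩ := hygraph p ⟨hp.1.1, hp.2⟩ y hy
    have h3 := (hΨd p hp.1.1 y.1 h1).comp_hasFDerivAt y (hasFDerivAt_fst (𝕜 := ℂ) (p := y))
    rw [← h2] at h3
    exact h3
  · intro p hp y hy y' hy'
    obtain ⟨h1, h2⟩ := hygraph p ⟨hp.1.1, hp.2⟩ y hy
    obtain ⟨h1', h2'⟩ := hygraph p ⟨hp.1.1, hp.2⟩ y' hy'
    -- The joining path lifts a straight segment to the graph. The lift may leave the `δ`-ball,
    -- which is why the definition of a chart has two radii.
    have hseg : ∀ t ∈ Icc (0 : ℝ) 1, y.1 + t • (y'.1 - y.1) ∈ ball x.1 δ :=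
      fun t ht => (convex_ball x.1 δ).add_smul_sub_mem h1 h1' ht
    refine ⟨fun t => (y.1 + t • (y'.1 - y.1), g (p, y.1 + t • (y'.1 - y.1))), ?_, ?_, ?_,
      fun t ht => hgraph p hp.1.1 _ (hseg t ht)⟩
    · refine ContDiffOn.prodMk (by fun_prop) (hgC.comp ?_ fun t ht => ⟨hp.1.1, hseg t ht⟩)
      fun_prop
    · simp [← h2]
    · simp [← h2']

end LocalChart

/-! ### Chains of charts along a closed path, and the period function. -/

section ChartChain

variable {E : Type*} [NormedAddCommGroup E] [NormedSpace ℝ E]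

/-- Charts are used at two scales. Large ones, of radius at most `η / 2`, carry the primitives `Φ i`
and have a Lebesgue number `r`. Small ones at the nodes `ℓ₀(i/m)` carry the marked points `Y i`, and
their joining paths stay within `r / 2` of the node. If consecutive nodes are less than `r / 2`
apart, such paths lie in both adjacent large charts, where the two primitives can be compared. -/
theorem exists_chart_chain {Z : E → Set (ℂ × ℂ)} {p₀ : E} {x₀ : ℂ × ℂ} (ℓ₀ : Path x₀ x₀)
    (hchart : ∀ s, HasLocalChart Z p₀ (ℓ₀ s)) {η : ℝ} (hη : 0 < η) :
    ∃ m : ℕ, 0 < m ∧ ∃ ε > 0, ∃ V : Set E, IsOpen V ∧ p₀ ∈ V ∧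
      ∃ (O : ℕ → Set (ℂ × ℂ)) (Φ : ℕ → E × (ℂ × ℂ) → ℂ) (Y : ℕ → E → ℂ × ℂ),
        Φ m = Φ 0 ∧ Y m = Y 0 ∧
        (∀ i ≤ m, DifferentiableOn ℝ (Φ i) (V ×ˢ O i)) ∧
        (∀ i ≤ m, DifferentiableOn ℝ (Y i) V) ∧
        (∀ i ≤ m, ∀ p ∈ V, ∀ y ∈ Z p ∩ O i, HasFDerivAt (fun z => Φ i (p, z)) (muForm y) y) ∧
        (∀ i ≤ m, ∀ p ∈ V, Y i p ∈ Z p ∩ O i) ∧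
        (∀ i < m, ∀ p ∈ V, Y (i + 1) p ∈ O i) ∧
        (∀ i < m, ∀ t ∈ Icc ((i : ℝ) / m) ((i + 1 : ℕ) / m), ∀ w,
          dist w (ℓ₀.extend t) < ε → w ∈ O i) ∧
        (∀ i < m, ∀ p ∈ V, ∀ w ∈ Z p, dist w (ℓ₀.extend ((i + 1 : ℕ) / m)) < ε →
          ∃ γ : ℝ → ℂ × ℂ, ContDiffOn ℝ 1 γ (Icc 0 1) ∧ γ 0 = Y (i + 1) p ∧ γ 1 = w ∧
            MapsTo γ (Icc 0 1) (Z p ∩ (O i ∩ O (i + 1)))) ∧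
        ∀ i < m, ∀ p ∈ V, ∃ γ : ℝ → ℂ × ℂ, ContDiffOn ℝ 1 γ (Icc 0 1) ∧ γ 0 = Y i p ∧
          γ 1 = Y (i + 1) p ∧ MapsTo γ (Icc 0 1) (Z p) ∧
          ∀ s ∈ Icc (0 : ℝ) 1, ∀ t ∈ Icc ((i : ℝ) / m) ((i + 1 : ℕ) / m),
            dist (γ s) (ℓ₀.extend t) < η := by
  have hK : ∀ y ∈ range ℓ₀, HasLocalChart Z p₀ y := by
    rintro _ ⟨s, rfl⟩
    exact hchart s
  have hmemK : ∀ t, ℓ₀.extend t ∈ range ℓ₀ := fun t => ⟨projIcc 0 1 zero_le_one t, rfl⟩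
  -- The charts are chosen as functions of the point, not of the index, so that equal first and last
  -- nodes give `Φ m = Φ 0` and `Y m = Y 0`.
  choose! δ hδ hδη V hV hpV Φ _ hΦ _ _ hprim hconn using
    fun y hy => hK y hy (η / 2) (half_pos hη)
  obtain ⟨r, hr, hcover⟩ := lebesgue_number_lemma_of_metric (c := fun y : range ℓ₀ => ball y.1 (δ y))
    (isCompact_range ℓ₀.continuous) (fun _ => isOpen_ball)
    fun y hy => mem_iUnion.2 ⟨⟨y, hy⟩, mem_ball_self (hδ y hy)⟩
  choose! τ hτ using hcover
  choose! δ' hδ' hδr V' hV' hpV' _ Y _ hY hYmem _ hconn' using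
    fun y hy => hK y hy (r / 2) (half_pos hr)
  obtain ⟨d, hd, hunif⟩ := Metric.uniformContinuousOn_iff.1
    (isCompact_Icc.uniformContinuousOn_of_continuous
      (ℓ₀.continuous_extend.continuousOn (s := Icc (0 : ℝ) 1))) (r / 2) (half_pos hr)
  obtain ⟨k, hk⟩ := exists_nat_one_div_lt hd
  set m := k + 1
  have hm : (0 : ℝ) < m := by positivity
  let y : ℕ → ℂ × ℂ := fun i => ℓ₀.extend (i / m)
  have hyK : ∀ i, y i ∈ range ℓ₀ := fun i => hmemK _
  have hy0 : y m = y 0 := by simp [y]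
  have h01 : ∀ i < m, Icc ((i : ℝ) / m) ((i + 1 : ℕ) / m) ⊆ Icc 0 1 := fun i hi =>
    Icc_subset_Icc (by positivity) ((div_le_one hm).2 (by exact_mod_cast hi))
  have hlen : ∀ i : ℕ, ((i + 1 : ℕ) : ℝ) / m = i / m + 1 / m := fun i => by push_cast; ring
  have hnode : ∀ i < m, ∀ t ∈ Icc ((i : ℝ) / m) ((i + 1 : ℕ) / m),
      dist (ℓ₀.extend t) (y i) < r / 2 := fun i hi t ht => by
    refine hunif t (h01 i hi ht) _ (h01 i hi ⟨le_rfl, by rw [hlen]; simp⟩) ?_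
    rw [Real.dist_eq, abs_of_nonneg (sub_nonneg.2 ht.1)]
    have := ht.2
    rw [hlen] at this
    have hk' : (1 : ℝ) / m < d := by simpa [m] using hk
    linarith
  have hsucc : ∀ i < m, dist (y (i + 1)) (y i) < r / 2 := fun i hi =>
    hnode i hi _ ⟨by rw [hlen]; simp, le_rfl⟩
  have hne : (Finset.range (m + 1)).Nonempty := ⟨0, by simp⟩
  set ε := min (r / 2) ((Finset.range (m + 1)).inf' hne fun i => δ' (y i))
  have hε : 0 < ε := lt_min (half_pos hr) ((Finset.lt_inf'_iff _).2 fun i _ => hδ' _ (hyK i))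
  have hεδ : ∀ i ≤ m, ε ≤ δ' (y i) := fun i hi =>
    (min_le_right _ _).trans (Finset.inf'_le _ (Finset.mem_range.2 (by omega)))
  let W : Set E := ⋂ i ∈ Finset.range (m + 1), V (τ (y i)) ∩ V' (y i)
  have hW : ∀ i ≤ m, ∀ p ∈ W, p ∈ V (τ (y i)) ∧ p ∈ V' (y i) := fun i hi p hp =>
    mem_iInter₂.1 hp i (Finset.mem_range.2 (by omega))
  let O : ℕ → Set (ℂ × ℂ) := fun i => ball (τ (y i)).1 (δ (τ (y i)))
  have hO : ∀ i, ball (y i) r ⊆ O i := fun i => hτ _ (hyK i)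
  have hO' : ∀ i, ball (y i) (r / 2) ⊆ O i := fun i =>
    (ball_subset_ball (half_le_self hr.le)).trans (hO i)
  have hOs : ∀ i < m, ball (y (i + 1)) (r / 2) ⊆ O i := fun i hi z hz => hO i (by
    have := dist_triangle z (y (i + 1)) (y i)
    have h1 := hsucc i hi
    rw [mem_ball] at hz ⊢
    linarith)
  have hYball : ∀ i ≤ m, ∀ p ∈ W, Y (y i) p ∈ ball (y i) (r / 2) := fun i hi p hp =>
    ball_subset_ball (hδr _ (hyK i)) (hYmem _ (hyK i) p (hW i hi p hp).2).2
  refine ⟨m, k.succ_pos, ε, hε, W, ?_, ?_, O, fun i => Φ (τ (y i)), fun i => Y (y i),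
    by simp only [hy0], by simp only [hy0], ?_, ?_, ?_, ?_, ?_, ?_, ?_, ?_⟩
  · exact isOpen_biInter_finset fun i _ => (hV _ (τ (y i)).2).inter (hV' _ (hyK i))
  · exact mem_iInter₂.2 fun i _ => ⟨hpV _ (τ (y i)).2, hpV' _ (hyK i)⟩
  · exact fun i hi => (hΦ _ (τ (y i)).2).mono (prod_mono (fun p hp => (hW i hi p hp).1) subset_rfl)
  · exact fun i hi => (hY _ (hyK i)).mono fun p hp => (hW i hi p hp).2
  · exact fun i hi p hp z hz => hprim _ (τ (y i)).2 p (hW i hi p hp).1 z hz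
  · exact fun i hi p hp => ⟨(hYmem _ (hyK i) p (hW i hi p hp).2).1, hO' i (hYball i hi p hp)⟩
  · exact fun i hi p hp => hOs i hi (hYball (i + 1) hi p hp)
  · intro i hi t ht w hw
    refine hO i ?_
    have := dist_triangle w (ℓ₀.extend t) (y i)
    have h1 := hnode i hi t ht
    have h2 : ε ≤ r / 2 := min_le_left _ _
    rw [mem_ball]
    linarith
  · intro i hi p hp w hwZ hw
    obtain ⟨γ, hγ, h0, h1, hmaps⟩ := hconn' _ (hyK (i + 1)) p (hW (i + 1) hi p hp).2 _
      (hYmem _ (hyK (i + 1)) p (hW (i + 1) hi p hp).2) w ⟨hwZ, hw.trans_le (hεδ (i + 1) hi)⟩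
    exact ⟨γ, hγ, h0, h1, fun t ht =>
      ⟨(hmaps ht).1, hOs i hi (hmaps ht).2, hO' (i + 1) (hmaps ht).2⟩⟩
  · intro i hi p hp
    obtain ⟨γ, hγ, h0, h1, hmaps⟩ := hconn _ (τ (y i)).2 p (hW i hi.le p hp).1 _
      ⟨(hYmem _ (hyK i) p (hW i hi.le p hp).2).1, hO' i (hYball i hi.le p hp)⟩ _
      ⟨(hYmem _ (hyK (i + 1)) p (hW (i + 1) hi p hp).2).1, hOs i hi (hYball (i + 1) hi p hp)⟩
    refine ⟨γ, hγ, h0, h1, fun t ht => (hmaps ht).1, fun s hs t ht => ?_⟩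
    have h2 : ℓ₀.extend t ∈ O i := hO i ((hnode i hi t ht).trans (half_lt_self hr))
    have h3 : dist (ℓ₀.extend t) (τ (y i)).1 < η / 2 :=
      lt_of_lt_of_le h2 (hδη _ (τ (y i)).2)
    have h4 : dist (γ s) (τ (y i)).1 < η / 2 := (hmaps hs).2
    have := dist_triangle_right (γ s) (ℓ₀.extend t) (τ (y i)).1
    linarith

/-- The difference of two primitives has zero derivative along `γ`. Working along one path avoids
any claim that chart overlaps are connected. -/
theorem sub_eq_sub_of_hasFDerivAt_muForm {γ : ℝ → ℂ × ℂ} (hγ : ContDiffOn ℝ 1 γ (Icc 0 1))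
    {Φ Φ' : ℂ × ℂ → ℂ} (hΦ : ∀ t ∈ Icc (0 : ℝ) 1, HasFDerivAt Φ (muForm (γ t)) (γ t))
    (hΦ' : ∀ t ∈ Icc (0 : ℝ) 1, HasFDerivAt Φ' (muForm (γ t)) (γ t)) :
    Φ (γ 1) - Φ (γ 0) = Φ' (γ 1) - Φ' (γ 0) := by
  have hd : ∀ t ∈ Icc (0 : ℝ) 1,
      HasDerivWithinAt (fun t => Φ (γ t) - Φ' (γ t)) 0 (Icc 0 1) t := fun t ht => by
    have h := (hγ.differentiableOn one_ne_zero t ht).hasDerivWithinAt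
    have h1 := ((hΦ t ht).restrictScalars ℝ).comp_hasDerivWithinAt t h
    have h2 := ((hΦ' t ht).restrictScalars ℝ).comp_hasDerivWithinAt t h
    exact (h1.sub h2).congr_deriv (sub_self _)
  have := constant_of_derivWithin_zero (fun t ht => (hd t ht).differentiableWithinAt)
    (fun t ht => (hd t (Ico_subset_Icc_self ht)).derivWithin
      (uniqueDiffOn_Icc zero_lt_one t (Ico_subset_Icc_self ht))) 1 (right_mem_Icc.2 zero_le_one)
  linear_combination this

/-- The period of a closed path depends differentiably on the curve, and does not change under
small deformations of the path. -/
theorem exists_period_function {Z : E → Set (ℂ × ℂ)} {p₀ : E} {x₀ : ℂ × ℂ} (ℓ₀ : Path x₀ x₀)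
    (hchart : ∀ s, HasLocalChart Z p₀ (ℓ₀ s)) :
    ∃ ε > 0, ∃ V : Set E, IsOpen V ∧ p₀ ∈ V ∧ ∃ J : E → ℂ, DifferentiableOn ℝ J V ∧
      ∀ p ∈ V, ∀ (x : ℂ × ℂ) (ℓ : Path x x), IsPiecewiseC1 ℓ → (∀ s, ℓ s ∈ Z p) →
        (∀ s, dist (ℓ s) (ℓ₀ s) < ε) → curveIntegral muForm ℓ = J p := by
  obtain ⟨m, hm, ε, hε, V, hV, hpV, O, Φ, Y, hΦm, hYm, hΦ, hY, hprim, hYmem, hYs, hclose, htrans, -⟩ :=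
    exists_chart_chain ℓ₀ hchart one_pos
  have hm' : (0 : ℝ) < m := by exact_mod_cast hm
  refine ⟨ε, hε, V, hV, hpV,
    fun p => ∑ i ∈ Finset.range m, (Φ i (p, Y (i + 1) p) - Φ i (p, Y i p)), ?_, ?_⟩
  · refine DifferentiableOn.fun_sum fun i hi => ?_
    have hi := Finset.mem_range.1 hi
    exact ((hΦ i hi.le).comp (differentiableOn_id.prodMk (hY (i + 1) hi))
      fun p hp => ⟨hp, hYs i hi p hp⟩).sub ((hΦ i hi.le).comp
      (differentiableOn_id.prodMk (hY i hi.le)) fun p hp => ⟨hp, (hYmem i hi.le p hp).2⟩)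
  · intro p hp x ℓ hℓ hZ hdist
    have hZ' : ∀ t, ℓ.extend t ∈ Z p := fun t => hZ _
    have hdist' : ∀ t, dist (ℓ.extend t) (ℓ₀.extend t) < ε := fun t => hdist _
    have hmono : ∀ i : ℕ, (i : ℝ) / m ≤ (i + 1 : ℕ) / m := fun i => by gcongr; omega
    have hle : ∀ i < m, ((i + 1 : ℕ) : ℝ) / m ≤ 1 := fun i hi =>
      (div_le_one hm').2 (by exact_mod_cast hi)
    have hmem : ∀ i < m, ∀ t ∈ Icc ((i : ℝ) / m) ((i + 1 : ℕ) / m), ℓ.extend t ∈ O i :=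
      fun i hi t ht => hclose i hi t ht _ (hdist' t)
    have hint : ∀ i < m, ∫ t in (i : ℝ) / m..(i + 1 : ℕ) / m,
        muForm (ℓ.extend t) (pathVelocity ℓ t) =
        Φ i (p, ℓ.extend ((i + 1 : ℕ) / m)) - Φ i (p, ℓ.extend (i / m)) := fun i hi =>
      hℓ.integral_muForm_eq_sub (by positivity) (hmono i) (hle i hi) (Φ := fun z => Φ i (p, z))
        fun t ht => hprim i hi.le p hp _ ⟨hZ' t, hmem i hi t ht⟩
    have hsum := intervalIntegral.sum_integral_adjacent_intervals (a := fun i : ℕ => (i : ℝ) / m)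
      (n := m) (μ := volume) (f := fun t => muForm (ℓ.extend t) (pathVelocity ℓ t))
      fun i hi => hℓ.intervalIntegrable_muForm.mono_set (by
        rw [uIcc_of_le (hmono i), uIcc_of_le zero_le_one]
        exact Icc_subset_Icc (by positivity) (hle i hi))
    simp only [Nat.cast_zero, zero_div, div_self hm'.ne'] at hsum
    rw [curveIntegral_muForm, ← hsum, ← sub_eq_zero, ← Finset.sum_sub_distrib]
    -- On the path from `Y (i + 1) p` to the division point of `ℓ`, `Φ i` may be exchanged for `Φ (i
    -- + 1)`. The errors then telescope, to zero since the chain and `ℓ` close up.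
    have hterm : ∀ i ∈ Finset.range m,
        (∫ t in (i : ℝ) / m..(i + 1 : ℕ) / m, muForm (ℓ.extend t) (pathVelocity ℓ t)) -
          (Φ i (p, Y (i + 1) p) - Φ i (p, Y i p)) =
        (Φ (i + 1) (p, ℓ.extend ((i + 1 : ℕ) / m)) - Φ (i + 1) (p, Y (i + 1) p)) -
          (Φ i (p, ℓ.extend (i / m)) - Φ i (p, Y i p)) := fun i hi => by
      have hi := Finset.mem_range.1 hi
      obtain ⟨γ, hγ, h0, h1, hmaps⟩ := htrans i hi p hp _ (hZ' _) (hdist' ((i + 1 : ℕ) / m))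
      have := sub_eq_sub_of_hasFDerivAt_muForm hγ (Φ := fun z => Φ i (p, z))
        (Φ' := fun z => Φ (i + 1) (p, z))
        (fun t ht => hprim i hi.le p hp _ ⟨(hmaps ht).1, (hmaps ht).2.1⟩)
        (fun t ht => hprim (i + 1) hi p hp _ ⟨(hmaps ht).1, (hmaps ht).2.2⟩)
      rw [h0, h1] at this
      rw [hint i hi]
      linear_combination this
    rw [Finset.sum_congr rfl hterm, Finset.sum_range_sub
      (fun i : ℕ => Φ i (p, ℓ.extend (i / m)) - Φ i (p, Y i p)), hΦm, hYm]
    simp [div_self hm'.ne']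

end ChartChain

/-! ### Continuation of a closed path to nearby curves. -/

section Concatenation

theorem exists_closedPath_of_pieces {m : ℕ} (hm : 0 < m) {Y : ℕ → ℂ × ℂ} (hY : Y m = Y 0)
    {γ : ℕ → ℝ → ℂ × ℂ} (hγ : ∀ i < m, ContDiffOn ℝ 1 (γ i) (Icc 0 1))
    (h0 : ∀ i < m, γ i 0 = Y i) (h1 : ∀ i < m, γ i 1 = Y (i + 1)) :
    ∃ ℓ : Path (Y 0) (Y 0), IsPiecewiseC1 ℓ ∧ ∀ t : I, ∃ i < m, ∃ s ∈ Icc (0 : ℝ) 1,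
      (t : ℝ) ∈ Icc ((i : ℝ) / m) ((i + 1 : ℕ) / m) ∧ ℓ t = γ i s := by
  have hm' : (0 : ℝ) < m := by exact_mod_cast hm
  classical
  -- At an interior node the floor selects the start of the next piece, which agrees with the end of
  -- the previous one. At `t = 1` there is no next piece, and the default `Y 0` equals `Y m`.
  let f : ℝ → ℂ × ℂ := fun t =>
    if ⌊t * m⌋₊ < m then γ ⌊t * m⌋₊ (t * m - ⌊t * m⌋₊) else Y 0
  have hf : ∀ i < m, ∀ t ∈ Icc ((i : ℝ) / m) ((i + 1 : ℕ) / m), f t = γ i (t * m - i) := by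
    intro i hi t ht
    rw [mem_Icc, div_le_iff₀ hm', le_div_iff₀ hm'] at ht
    rcases ht.2.lt_or_eq with h | h
    · have hfl : ⌊t * m⌋₊ = i := by
        rw [Nat.floor_eq_iff ((Nat.cast_nonneg i).trans ht.1)]
        exact ⟨ht.1, by exact_mod_cast h⟩
      simp only [f, hfl, hi, if_true]
    · have hfl : ⌊t * m⌋₊ = i + 1 := by rw [h, Nat.floor_natCast]
      simp only [f, hfl]
      rw [h]
      simp only [Nat.cast_add, Nat.cast_one, sub_self, add_sub_cancel_left, h1 i hi]
      split_ifs with hlt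
      · exact h0 _ hlt
      · rw [← hY, show i + 1 = m by omega]
  have hunit : ∀ i < m, ∀ t ∈ Icc ((i : ℝ) / m) ((i + 1 : ℕ) / m), t * m - i ∈ Icc (0 : ℝ) 1 := by
    intro i hi t ht
    rw [mem_Icc, div_le_iff₀ hm', le_div_iff₀ hm'] at ht
    push_cast at ht
    constructor <;> linarith
  have hfC : ∀ i < m, ContDiffOn ℝ 1 f (Icc ((i : ℝ) / m) ((i + 1 : ℕ) / m)) := fun i hi =>
    ((hγ i hi).comp (f := fun t : ℝ => t * m - i) (by fun_prop) (hunit i hi)).congr (hf i hi)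
  have hmono : ∀ i : ℕ, (i : ℝ) / m ≤ (i + 1 : ℕ) / m := fun i => by gcongr; omega
  have hcont : ∀ k ≤ m, ContinuousOn f (Icc 0 ((k : ℝ) / m)) := by
    intro k
    induction k with
    | zero => intro _; simp
    | succ k ih =>
      intro hk
      rw [← Icc_union_Icc_eq_Icc (by positivity) (hmono k)]
      exact (ih (by omega)).union_of_isClosed (hfC k hk).continuousOn isClosed_Icc isClosed_Icc
  have hcont1 : ContinuousOn f I := by simpa [div_self hm'.ne'] using hcont m le_rfl
  have hf0 : f 0 = Y 0 := by
    rw [hf 0 hm 0 ⟨by simp, by positivity⟩]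
    simpa using h0 0 hm
  have hf1 : f 1 = Y 0 := by simp [f]
  have hext : EqOn (Path.ofLine hcont1 hf0 hf1).extend f I := fun t ht => Path.extend_apply _ ht
  refine ⟨Path.ofLine hcont1 hf0 hf1, ⟨m, fun i => i / m, fun i j hij => by dsimp only; gcongr,
    by simp, div_self hm'.ne', fun i hi => (hfC i hi).congr fun t ht => hext ?_⟩, fun t => ?_⟩
  · exact Icc_subset_Icc (by positivity) ((div_le_one hm').2 (by exact_mod_cast hi)) ht
  · obtain ⟨i, hi, hti⟩ : ∃ i < m, (t : ℝ) ∈ Icc ((i : ℝ) / m) ((i + 1 : ℕ) / m) := by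
      simp only [mem_Icc, div_le_iff₀ hm', le_div_iff₀ hm']
      rcases t.2.2.lt_or_eq with h | h
      · refine ⟨⌊(t : ℝ) * m⌋₊, ?_, Nat.floor_le (mul_nonneg t.2.1 hm'.le), ?_⟩
        · rw [Nat.floor_lt (mul_nonneg t.2.1 hm'.le)]
          nlinarith
        · exact_mod_cast (Nat.lt_floor_add_one _).le
      · refine ⟨m - 1, by omega, ?_, ?_⟩
        · rw [h, one_mul]
          exact_mod_cast Nat.sub_le m 1
        · rw [h, one_mul, Nat.sub_add_cancel hm]
    exact ⟨i, hi, _, hunit i hi t hti, hti, hf i hi t hti⟩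

variable {E : Type*} [NormedAddCommGroup E] [NormedSpace ℝ E]

/-- A closed path continues to the nearby curves. -/
theorem exists_closedPath_near {Z : E → Set (ℂ × ℂ)} {p₀ : E} {x₀ : ℂ × ℂ} (ℓ₀ : Path x₀ x₀)
    (hchart : ∀ s, HasLocalChart Z p₀ (ℓ₀ s)) {ε : ℝ} (hε : 0 < ε) :
    ∃ V : Set E, IsOpen V ∧ p₀ ∈ V ∧ ∀ p ∈ V, ∃ (x : ℂ × ℂ) (ℓ : Path x x),
      IsPiecewiseC1 ℓ ∧ (∀ s, ℓ s ∈ Z p) ∧ ∀ s, dist (ℓ s) (ℓ₀ s) < ε := by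
  obtain ⟨m, hm, -, -, V, hV, hpV, -, -, Y, -, hYm, -, -, -, -, -, -, -, hpiece⟩ :=
    exists_chart_chain ℓ₀ hchart hε
  refine ⟨V, hV, hpV, fun p hp => ?_⟩
  choose! γ hγ h0 h1 hZ hdist using fun i hi => hpiece i hi p hp
  obtain ⟨ℓ, hℓ, hpt⟩ := exists_closedPath_of_pieces hm (congrFun hYm p) hγ h0 h1
  refine ⟨_, ℓ, hℓ, fun t => ?_, fun t => ?_⟩
  · obtain ⟨i, hi, s, hs, -, h⟩ := hpt t
    exact h ▸ hZ i hi hs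
  · obtain ⟨i, hi, s, hs, ht, h⟩ := hpt t
    have := hdist i hi s hs t ht
    rwa [Path.extend_extends', ← h] at this

end Concatenation

/-! ### Charts at smooth points of the spectral curve. -/

section ZeroLocus

variable {E : Type*} [NormedAddCommGroup E] [NormedSpace ℝ E]

/-- Where `∂F/∂μ` vanishes, at a branch point of the projection to `ζ`, the derivative `∂F/∂ζ` does
not, and the chart is built with the coordinates exchanged. -/
theorem hasLocalChart_of_smooth_point [CompleteSpace E] {U : Set (E × ℂ × ℂ)} (hU : IsOpen U)
    {F : E → ℂ → ℂ → ℂ} (hF : ContDiffOn ℝ 1 (fun q : E × ℂ × ℂ => F q.1 q.2.1 q.2.2) U)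
    (hF₁ : ∀ q ∈ U, DifferentiableAt ℂ (fun z => F q.1 z q.2.2) q.2.1)
    (hF₂ : ∀ q ∈ U, DifferentiableAt ℂ (fun w => F q.1 q.2.1 w) q.2.2)
    {Z : E → Set (ℂ × ℂ)} {p₀ : E} {x : ℂ × ℂ} (hxU : (p₀, x) ∈ U) (hx : x ∈ Z p₀)
    (hZ : ∀ p y, (p, y) ∈ U → (y ∈ Z p ↔ F p y.1 y.2 = 0))
    (hne : ¬(deriv (fun z => F p₀ z x.2) x.1 = 0 ∧ deriv (fun w => F p₀ x.1 w) x.2 = 0)) :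
    HasLocalChart Z p₀ x := by
  by_cases hw : deriv (fun w => F p₀ x.1 w) x.2 = 0
  · have hz : deriv (fun z => F p₀ z x.2) x.1 ≠ 0 := fun h => hne ⟨h, hw⟩
    have hk : ContDiff ℝ 1 (fun q : (E × ℂ) × ℂ => (q.1.1, q.2, q.1.2)) := by fun_prop
    have hH : ContDiffOn ℝ 1 (fun q : (E × ℂ) × ℂ => F q.1.1 q.2 q.1.2)
        ((fun q : (E × ℂ) × ℂ => (q.1.1, q.2, q.1.2)) ⁻¹' U) :=
      hF.comp hk.contDiffOn fun q hq => hq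
    exact HasLocalChart.of_swap (hasLocalChart_of_deriv_ne_zero (x := x.swap)
      (hU.preimage hk.continuous) hH (fun q hq => hF₂ _ hq) (fun q hq => hF₁ _ hq)
      hxU hx (fun p y hy => hZ p y.swap hy) hz)
  · have hk : ContDiff ℝ 1 (fun q : (E × ℂ) × ℂ => (q.1.1, q.1.2, q.2)) := by fun_prop
    have hH : ContDiffOn ℝ 1 (fun q : (E × ℂ) × ℂ => F q.1.1 q.1.2 q.2)
        ((fun q : (E × ℂ) × ℂ => (q.1.1, q.1.2, q.2)) ⁻¹' U) :=
      hF.comp hk.contDiffOn fun q hq => hq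
    exact hasLocalChart_of_deriv_ne_zero (hU.preimage hk.continuous) hH
      (fun q hq => hF₁ _ hq) (fun q hq => hF₂ _ hq) hxU hx (fun p y hy => hZ p y hy) hw

end ZeroLocus

theorem differentiableAt_det {ι : Type*} [Fintype ι] [DecidableEq ι] {M : ℂ → Matrix ι ι ℂ} {z : ℂ}
    (hM : ∀ i j, DifferentiableAt ℂ (fun w => M w i j) z) :
    DifferentiableAt ℂ (fun w => (M w).det) z := by
  simp only [Matrix.det_apply]
  refine DifferentiableAt.fun_sum fun e _ => DifferentiableAt.const_smul ?_ _
  exact DifferentiableAt.fun_finsetProd fun i _ => hM _ _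

namespace SpectralData

variable {N n : ℕ} {r : Option (Fin n) → ℕ} {T D : Type*}

theorem differentiableAt_F_right (S : SpectralData N n r T D) (p : T × D) (ζ μ : ℂ) :
    DifferentiableAt ℂ (fun m => S.F p ζ m) μ := by
  refine differentiableAt_det fun i j => ?_
  simp only [Matrix.sub_apply, Matrix.smul_apply]
  fun_prop

theorem differentiableAt_F_left (S : SpectralData N n r T D) (p : T × D) {ζ : ℂ} (μ : ℂ)
    (hζ : ∀ ν, ζ ≠ S.b ν p) : DifferentiableAt ℂ (fun z => S.F p z μ) ζ := by
  refine differentiableAt_det fun i j => ?_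
  simp only [coeffMatrix, Matrix.sub_apply, Matrix.smul_apply, Matrix.sum_apply, smul_eq_mul]
  refine DifferentiableAt.sub_const (DifferentiableAt.fun_sub ?_ (by fun_prop)) _
  refine DifferentiableAt.fun_sum fun ν _ => DifferentiableAt.fun_sum fun k _ => ?_
  have h : DifferentiableAt ℂ (fun z => (z - S.b ν p) ^ (k + 1)) ζ := by fun_prop
  exact (h.fun_inv (pow_ne_zero _ (sub_ne_zero.2 (hζ ν)))).mul_const _

/-- Compactness of the unit interval turns joint continuity into uniform closeness in `s`. -/
theorem IsClosedPathFamily.eventually_dist_lt [TopologicalSpace T] [TopologicalSpace D]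
    {S : SpectralData N n r T D} {W : Set (T × D)} {x : T × D → ℂ × ℂ}
    {ℓ : ∀ p, Path (x p) (x p)} (h : S.IsClosedPathFamily W ℓ) {p : T × D} (hp : p ∈ W) {ε : ℝ}
    (hε : 0 < ε) : ∀ᶠ p' in 𝓝[W] p, ∀ s, dist (ℓ p' s) (ℓ p s) < ε := by
  obtain ⟨v, hv, hvε⟩ := isCompact_univ.mem_uniformity_of_prod
    (f := fun (p : T × D) (s : I) => ℓ p s) h.2 hp (dist_mem_uniformity hε)
  filter_upwards [hv] with p' hp' s
  exact hvε p' hp' s (mem_univ s)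

variable [NormedAddCommGroup T] [NormedSpace ℝ T] [NormedAddCommGroup D] [NormedSpace ℝ D]
  {S : SpectralData N n r T D}

namespace IsParameterization

theorem isOpen_dom_diff_fixedSing (hS : S.IsParameterization) : IsOpen (S.dom \ S.fixedSing) := by
  refine isOpen_iff_mem_nhds.2 fun p hp => ?_
  have hdom := hS.isOpen_dom.mem_nhds hp.1
  have hb : ∀ ν, ContinuousAt (S.b ν) p := fun ν => (hS.continuousOn_b ν).continuousAt hdom
  have ht : ∀ ν i, ContinuousAt (S.t ν (r ν) i) p := fun ν i =>
    (hS.continuousOn_t ν _ i le_rfl).continuousAt hdom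
  have h := hp.2
  simp only [fixedSing, mem_ofPred_eq, not_or, not_exists, not_and] at h
  obtain ⟨h1, h2, h3⟩ := h
  have e1 : ∀ᶠ p' in 𝓝 p, ∀ ν ρ, ν ≠ ρ → S.b ν p' ≠ S.b ρ p' := by
    simp only [Filter.eventually_all]
    exact fun ν ρ hne => (ContinuousAt.ne_iff_eventually_ne (hb ν) (hb ρ)).1 (h1 ν ρ hne)
  have e2 : ∀ᶠ p' in 𝓝 p, ∀ ν i j, i ≠ j → S.t ν (r ν) i p' ≠ S.t ν (r ν) j p' := by
    simp only [Filter.eventually_all]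
    exact fun ν i j hne => (ContinuousAt.ne_iff_eventually_ne (ht ν i) (ht ν j)).1 (h2 ν i j hne)
  have e3 : ∀ᶠ p' in 𝓝 p, ∀ ν k, S.t ν (r ν) k p' ≠ 0 := by
    simp only [Filter.eventually_all]
    exact fun ν k => (ht ν k).eventually_ne (h3 ν k)
  filter_upwards [hdom, e1, e2, e3] with p' h0 h1 h2 h3
  refine ⟨h0, ?_⟩
  simp only [fixedSing, mem_ofPred_eq, not_or, not_exists, not_and]
  exact ⟨h1, h2, h3⟩

theorem isOpen_regular (hS : S.IsParameterization) :
    IsOpen {q : (T × D) × ℂ × ℂ | q.1 ∈ S.dom \ S.fixedSing ∧ ∀ ν, q.2.1 ≠ S.b ν q.1} := by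
  refine isOpen_iff_mem_nhds.2 fun q hq => ?_
  have hb : ∀ ν, ContinuousAt (fun q : (T × D) × ℂ × ℂ => S.b ν q.1) q := fun ν =>
    ContinuousAt.comp (g := S.b ν)
      ((hS.continuousOn_b ν).continuousAt (hS.isOpen_dom.mem_nhds hq.1.1)) continuousAt_fst
  have e : ∀ᶠ q' in 𝓝 q, ∀ ν, q'.2.1 ≠ S.b ν q'.1 := by
    simp only [Filter.eventually_all]
    have hζ : ContinuousAt (fun q : (T × D) × ℂ × ℂ => q.2.1) q := by fun_prop
    exact fun ν => (ContinuousAt.ne_iff_eventually_ne hζ (hb ν)).1 (hq.2 ν)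
  filter_upwards [continuousAt_fst.eventually (hS.isOpen_dom_diff_fixedSing.mem_nhds hq.1), e]
    with q' h1 h2
  exact ⟨h1, h2⟩

theorem hasLocalChart [FiniteDimensional ℝ T] [FiniteDimensional ℝ D]
    (hS : S.IsParameterization) {p₀ : T × D} (hp₀ : p₀ ∈ S.dom \ S.fixedSing) {x : ℂ × ℂ}
    (hx : x ∈ S.curve p₀) (hns : x ∉ S.singularPoints p₀) : HasLocalChart S.curve p₀ x := by
  have : CompleteSpace (T × D) := FiniteDimensional.complete ℝ _
  exact hasLocalChart_of_smooth_point hS.isOpen_regular hS.contDiffOn_F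
    (fun q hq => S.differentiableAt_F_left q.1 q.2.2 hq.2)
    (fun q _ => S.differentiableAt_F_right q.1 q.2.1 q.2.2) ⟨hp₀, hx.1⟩ hx
    (fun p y hy => ⟨fun h => h.2, fun h => ⟨hy.2, h⟩⟩) fun h => hns ⟨hx, h⟩

end IsParameterization

end SpectralData

end

/-! ### Continuity and differentiability of the periods. -/

namespace SpectralData

theorem continuousWithinAt_periodJ_of_projLength_le {N n : ℕ} {r : Option (Fin n) → ℕ} {T D : Type*}
    [TopologicalSpace T] [TopologicalSpace D] {S : SpectralData N n r T D}
    {W : Set (T × D)} {x : T × D → ℂ × ℂ} {ℓ : ∀ p, Path (x p) (x p)}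
    (hℓ : S.IsClosedPathFamily W ℓ) {p : T × D} (hp : p ∈ W) {M : ℝ}
    (hM : ∀ᶠ p' in 𝓝[W] p, projLength (ℓ p') ≤ M) :
    ContinuousWithinAt (fun p' => periodJ (ℓ p')) W p := by
  -- `max M 0` makes `C` nonnegative, so that division by `C + 1` is safe.
  set C := max M 0 + ∫ t in (0 : ℝ)..1, ‖(pathVelocity (ℓ p) t).2‖
  have hC : 0 ≤ C := add_nonneg (le_max_right _ _)
    (intervalIntegral.integral_nonneg zero_le_one fun _ _ => norm_nonneg _)
  refine Metric.tendsto_nhds.2 fun e he => ?_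
  filter_upwards [hℓ.eventually_dist_lt hp (ε := e / (C + 1)) (by positivity), hM,
    self_mem_nhdsWithin] with p' h1 h2 h3
  have h := abs_periodJ_sub_le (hℓ.1 p hp).1 (hℓ.1 p' h3).1 fun s => (h1 s).le
  rw [Real.dist_eq]
  calc |periodJ (ℓ p') - periodJ (ℓ p)| ≤ e / (C + 1) * C := h.trans (by
        gcongr
        exact add_le_add (h2.trans (le_max_left _ _)) le_rfl)
    _ < e / (C + 1) * (C + 1) := by gcongr; exact lt_add_one C
    _ = e := div_mul_cancel₀ _ (by positivity)

end SpectralData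

namespace SpectralData.IsParameterization

variable {N n : ℕ} {r : Option (Fin n) → ℕ} {T D : Type*}
  [NormedAddCommGroup T] [NormedSpace ℝ T] [FiniteDimensional ℝ T]
  [NormedAddCommGroup D] [NormedSpace ℝ D] [FiniteDimensional ℝ D] {S : SpectralData N n r T D}

theorem exists_period_function (hS : S.IsParameterization) {p₀ : T × D}
    (hp₀ : p₀ ∈ S.dom \ S.fixedSing) {x₀ : ℂ × ℂ} {ℓ₀ : Path x₀ x₀}
    (hℓ₀ : S.IsClosedPathOn p₀ ℓ₀) (hns : ∀ s, ℓ₀ s ∉ S.singularPoints p₀) :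
    ∃ ε > 0, ∃ V : Set (T × D), IsOpen V ∧ p₀ ∈ V ∧
      ∃ J : T × D → ℝ, DifferentiableOn ℝ J V ∧ ∀ p ∈ V, ∀ (x : ℂ × ℂ) (ℓ : Path x x),
        S.IsClosedPathOn p ℓ → (∀ s, dist (ℓ s) (ℓ₀ s) < ε) → periodJ ℓ = J p := by
  obtain ⟨ε, hε, V, hV, hpV, J, hJ, hper⟩ := _root_.exists_period_function ℓ₀
    fun s => hS.hasLocalChart hp₀ (hℓ₀.2 s) (hns s)
  exact ⟨ε, hε, V, hV, hpV, fun p => (J p).re,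
    Complex.reCLM.differentiable.comp_differentiableOn hJ,
    fun p hp x ℓ hℓ hd => congrArg Complex.re (hper p hp x ℓ hℓ.1 hℓ.2 hd)⟩

theorem differentiableWithinAt_periodJ (hS : S.IsParameterization) {W : Set (T × D)}
    (hW : W ⊆ S.dom \ S.fixedSing) {x : T × D → ℂ × ℂ} {ℓ : ∀ p, Path (x p) (x p)}
    (hℓ : S.IsClosedPathFamily W ℓ) {p : T × D} (hp : p ∈ W)
    (hns : ∀ s, ℓ p s ∉ S.singularPoints p) :
    DifferentiableWithinAt ℝ (fun p' => periodJ (ℓ p')) W p := by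
  obtain ⟨ε, hε, V, hV, hpV, J, hJ, hper⟩ := hS.exists_period_function (hW hp) (hℓ.1 p hp) hns
  have hJp : DifferentiableWithinAt ℝ J W p :=
    (hJ.differentiableAt (hV.mem_nhds hpV)).differentiableWithinAt
  refine hJp.congr_of_eventuallyEq_of_mem ?_ hp
  filter_upwards [hℓ.eventually_dist_lt hp hε, mem_nhdsWithin_of_mem_nhds (hV.mem_nhds hpV),
    self_mem_nhdsWithin] with p' h1 h2 h3
  exact hper p' h2 _ _ (hℓ.1 p' h3) h1

end SpectralData.IsParameterization

theorem mainTheorem5 {N n : ℕ} {r : Option (Fin n) → ℕ} {T D : Type*}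
    [NormedAddCommGroup T] [NormedSpace ℝ T] [FiniteDimensional ℝ T]
    [NormedAddCommGroup D] [NormedSpace ℝ D] [FiniteDimensional ℝ D]
    (S : SpectralData N n r T D) (hS : S.IsParameterization) :
    -- continuity outside the fixed singularities, at the points of the discriminant set included;
    -- only where `ℓ` runs into a singular point of the curve (which needs `p ∈ S.discrSet`) is it
    -- required that the contours do not become infinitely long
    (∀ W ⊆ S.dom \ S.fixedSing, ∀ (x : T × D → ℂ × ℂ) (ℓ : ∀ p, Path (x p) (x p)),
      S.IsClosedPathFamily W ℓ →
      (∀ p ∈ W, (∃ s, ℓ p s ∈ S.singularPoints p) →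
        ∃ M : ℝ, ∀ᶠ p' in 𝓝[W] p, projLength (ℓ p') ≤ M) →
      ContinuousOn (fun p => periodJ (ℓ p)) W) ∧
    -- differentiability outside the discriminant set
    (∀ W ⊆ S.dom \ S.fixedSing, ∀ (x : T × D → ℂ × ℂ) (ℓ : ∀ p, Path (x p) (x p)),
      S.IsClosedPathFamily W ℓ →
      ∀ p ∈ W, (p ∉ S.discrSet ∨ ∀ s, ℓ p s ∉ S.singularPoints p) →
        DifferentiableWithinAt ℝ (fun p' => periodJ (ℓ p')) W p) ∧
    -- a single closed path continues to the nearby curves, and its period is then a well-defined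
    -- differentiable function of the parameters
    (∀ p₀ ∈ S.dom \ S.fixedSing, ∀ (x₀ : ℂ × ℂ) (ℓ₀ : Path x₀ x₀), S.IsClosedPathOn p₀ ℓ₀ →
      (p₀ ∉ S.discrSet ∨ ∀ s, ℓ₀ s ∉ S.singularPoints p₀) →
      ∀ ε₀ > 0, ∃ ε > 0, ε < ε₀ ∧ ∃ V ⊆ S.dom \ S.fixedSing, IsOpen V ∧ p₀ ∈ V ∧
        ∃ J : T × D → ℝ, DifferentiableOn ℝ J V ∧ ∀ p ∈ V,
          (∃ (x : ℂ × ℂ) (ℓ : Path x x), S.IsClosedPathOn p ℓ ∧ ∀ s, dist (ℓ s) (ℓ₀ s) < ε) ∧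
          (∀ (x : ℂ × ℂ) (ℓ : Path x x), S.IsClosedPathOn p ℓ →
            (∀ s, dist (ℓ s) (ℓ₀ s) < ε) → periodJ ℓ = J p)) := by
  have havoid : ∀ p ∈ S.dom \ S.fixedSing, ∀ {y : ℂ × ℂ} (c : Path y y),
      (p ∉ S.discrSet ∨ ∀ s, c s ∉ S.singularPoints p) → ∀ s, c s ∉ S.singularPoints p :=
    fun p hp y c h s hs => h.elim (fun h => h ⟨hp.1, _, hs⟩) fun h => h s hs
  refine ⟨fun W hW x ℓ hℓ hlen p hp => ?_, fun W hW x ℓ hℓ p hp h => ?_,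
    fun p₀ hp₀ x₀ ℓ₀ hℓ₀ h ε₀ hε₀ => ?_⟩
  -- The length bound is needed only when the path meets a singular point. Otherwise continuity
  -- follows from differentiability.
  · by_cases hs : ∃ s, ℓ p s ∈ S.singularPoints p
    · obtain ⟨M, hM⟩ := hlen p hp hs
      exact SpectralData.continuousWithinAt_periodJ_of_projLength_le hℓ hp hM
    · exact (hS.differentiableWithinAt_periodJ hW hℓ hp (not_exists.1 hs)).continuousWithinAt
  · exact hS.differentiableWithinAt_periodJ hW hℓ hp (havoid p (hW hp) _ h)
  · have hns := havoid p₀ hp₀ ℓ₀ h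
    obtain ⟨ε₁, hε₁, V₁, hV₁, hp₁, J, hJ, hper⟩ := hS.exists_period_function hp₀ hℓ₀ hns
    -- One radius serves both claims: being at most `ε₁` it fixes the period, and a nearby closed
    -- path exists for every positive radius.
    have hε : 0 < min ε₁ (ε₀ / 2) := lt_min hε₁ (half_pos hε₀)
    obtain ⟨V₂, hV₂, hp₂, hex⟩ := exists_closedPath_near ℓ₀
      (fun s => hS.hasLocalChart hp₀ (hℓ₀.2 s) (hns s)) hε
    refine ⟨min ε₁ (ε₀ / 2), hε, (min_le_right _ _).trans_lt (half_lt_self hε₀),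
      V₁ ∩ V₂ ∩ (S.dom \ S.fixedSing), Set.inter_subset_right,
      (hV₁.inter hV₂).inter hS.isOpen_dom_diff_fixedSing, ⟨⟨hp₁, hp₂⟩, hp₀⟩, J,
      hJ.mono fun p hp => hp.1.1, fun p hp => ⟨?_, fun x ℓ hℓ hd => ?_⟩⟩
    · obtain ⟨x, ℓ, hℓ, hZ, hd⟩ := hex p hp.1.2
      exact ⟨x, ℓ, ⟨hℓ, hZ⟩, hd⟩
    · exact hper p hp.1.1 x ℓ hℓ fun s => (hd s).trans_le (min_le_left _ _)
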